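/- Let $m\ge 1$, let $a_i,b_i>0$ $(i=1,\dots,m)$ be real, $Q_i(z,w)=1-a_iz-b_iw$, and suppose that the lines $\{Q_i=0\}\subset\mathbb C^2$ are in general position: $\Delta_{ij}:=a_ib_j-a_jb_i\ne 0$ for $i\ne j$ (any two lines meet in one point), and no three of the lines have a common point. Let $f(x,y)$ be the Taylor coefficients at the origin of $$F(z,w)=\frac1{\prod_{i=1}^mQ_i(z,w)}=\sum_{x,y\ge 0}f(x,y)z^xw^y .$$ Let $M=\{(z,w)\in\mathbb R^2: z\ge 0,\ w\ge 0,\ Q_i(z,w)\ge 0,\ i=1,\dots,m\}$. Number the lines so that those carrying non-degenerate sides of $M$ are exactly the first $r$ ones and $\frac{a_1}{b_1}<\dots<\frac{a_r}{b_r}$. For $p,q\ge 0$ put $z_i=\frac{p}{a_i(p+q)}$, $w_i=\frac{q}{b_i(p+q)}$ (a solution of $Q_i=qz\,\partial_zQ_i-pw\,\partial_wQ_i=0$), and let $(z_{ij},w_{ij})$ be the solution of $Q_i=Q_j=0$. Let $K_i\subset\mathbb R^2_{\ge0}$ be the set of $(p,q)$ for which $(z_i,w_i)\in M$ and $z^pw^q$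 attains both its maximum over $M$ and its maximum over $\{Q_i=0\}\cap\mathbb R^2_{\ge 0}$ at $(z_i,w_i)$; let $\Omega_{ij}\subset\mathbb R^2_{\ge0}$ be the set of $(p,q)$ for which $(z_{ij},w_{ij})\in M$ and $z^pw^q$ attains its maximum over $M$ at $(z_{ij},w_{ij})$. Then there are real constants $A_{ij}$ $(i<j)$ with $$F=\sum_{1\le i<j\le m}\frac{A_{ij}}{Q_iQ_j}\qquad\text{if } m\ge 2,$$ such that for all $(p,q)\in\mathbb Z^2_{\ge0}$, on the diagonal $x=kp$, $y=kq$, as $k\to+\infty$: 1. if $(p,q)\in\operatorname{Int}K_i$, then $\displaystyle f(x,y)\sim\frac{c_i}{\sqrt k}\,\frac1{z_i^{x+1}w_i^{y+1}}$ with a constant $c_i=c_i(p,q)>0$ not depending on $k$; 2. if $(p,q)\in\operatorname{Int}\Omega_{i,i+1}$, $1\le i<r$, then $\displaystyle f(x,y)\sim-\frac{A_{i,i+1}}{\Delta_{i,i+1}}\,\frac1{z_{i,i+1}^{x+1}w_{i,i+1}^{y+1}}$. These cases cover almost every diagonal: there are finitely many rays from the origin such that every $(p,q)\in\mathbb Z^2_{\ge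 0}$ outside them lies in the interior of one of the cones $K_i$ $(i\le r)$, $\Omega_{i,i+1}$ $(i<r)$, and lies in the interior of every cone $K_i$ $(i\le m)$ or $\Omega_{i,i+1}$ $(i<r)$ that contains it. -/

import Mathlib

open Filter Topology Asymptotics

noncomputable section

namespace LinearPoles

/-- The linear factor `1 - α z - β w`. -/
def factor {R : Type*} [CommRing R] (α β z w : R) : R := 1 - α * z - β * w

/-- The affine complex line `1 - a_i z - b_i w = 0` in `ℂ²`. -/
def complexLine {m : ℕ} (a b : Fin m → ℝ) (i : Fin m) : Set (ℂ × ℂ) :=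
  {P | factor (a i : ℂ) (b i : ℂ) P.1 P.2 = 0}

/-- The determinant `Δ_{ij} = a_i b_j - a_j b_i`. -/
def Delta {m : ℕ} (a b : Fin m → ℝ) (i j : Fin m) : ℝ := a i * b j - a j * b i

/-- General position: any two of the lines meet in exactly one point (the determinant is nonzero),
and no three of them have a common point. -/
structure GeneralPosition {m : ℕ} (a b : Fin m → ℝ) : Prop where
  pair : ∀ i j, i ≠ j → Delta a b i j ≠ 0
  triple : ∀ i j k, i ≠ j → j ≠ k → i ≠ k →
    complexLine a b i ∩ complexLine a b j ∩ complexLine a b k = ∅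

/-- The rational function `F = 1 / ∏ Q_i` of two complex variables. -/
def ratFun {m : ℕ} (a b : Fin m → ℝ) (P : ℂ × ℂ) : ℂ :=
  1 / ∏ i, factor (a i : ℂ) (b i : ℂ) P.1 P.2

/-- `f` is the family of Taylor coefficients of `F` at the origin:
`F(z, w) = ∑ f(x, y) z ^ x w ^ y` for all `(z, w)` near `(0, 0)`. -/
def IsTaylorCoeff (F : ℂ × ℂ → ℂ) (f : ℕ → ℕ → ℂ) : Prop :=
  ∀ᶠ P : ℂ × ℂ in 𝓝 0, HasSum (fun n : ℕ × ℕ => f n.1 n.2 * P.1 ^ n.1 * P.2 ^ n.2) (F P)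

/-- `F = ∑_{i<j} A_{ij} / (Q_i Q_j)` off the poles of `F`. Only the values `A i j` with `i < j`
are used. -/
def IsPartialFraction {m : ℕ} (a b : Fin m → ℝ) (A : Fin m → Fin m → ℝ) : Prop :=
  ∀ P : ℂ × ℂ, (∀ i, P ∉ complexLine a b i) →
    ratFun a b P = ∑ i, ∑ j ∈ Finset.Ioi i,
      (A i j : ℂ) / (factor (a i : ℂ) (b i : ℂ) P.1 P.2 * factor (a j : ℂ) (b j : ℂ) P.1 P.2)

/-- The closed polygon `M`: `z ≥ 0`, `w ≥ 0` and `Q_i(z, w) ≥ 0` for all `i`. -/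
def polygon {m : ℕ} (a b : Fin m → ℝ) : Set (ℝ × ℝ) :=
  {P | 0 ≤ P.1 ∧ 0 ≤ P.2 ∧ ∀ i, 0 ≤ factor (a i) (b i) P.1 P.2}

/-- The part of the line `Q_i = 0` in the closed positive quadrant of `ℝ²`. -/
def posLine {m : ℕ} (a b : Fin m → ℝ) (i : Fin m) : Set (ℝ × ℝ) :=
  {P | 0 ≤ P.1 ∧ 0 ≤ P.2 ∧ factor (a i) (b i) P.1 P.2 = 0}

/-- The line `Q_i = 0` carries a (non-degenerate) side of `M`. -/
def IsSide {m : ℕ} (a b : Fin m → ℝ) (i : Fin m) : Prop :=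
  (posLine a b i ∩ polygon a b).Nontrivial

/-- The monomial `z ^ p w ^ q` with real exponents `d = (p, q)`, on the closed quadrant. -/
def monomial (d P : ℝ × ℝ) : ℝ := P.1 ^ d.1 * P.2 ^ d.2

/-- `(z_i, w_i) = (p / (a_i (p + q)), q / (b_i (p + q)))`. -/
def critPt {m : ℕ} (a b : Fin m → ℝ) (i : Fin m) (d : ℝ × ℝ) : ℝ × ℝ :=
  (d.1 / (a i * (d.1 + d.2)), d.2 / (b i * (d.1 + d.2)))

/-- `(z_{ij}, w_{ij})`, the common point of the lines `Q_i = 0` and `Q_j = 0`. -/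
def crossPt {m : ℕ} (a b : Fin m → ℝ) (i j : Fin m) : ℝ × ℝ :=
  ((b j - b i) / Delta a b i j, (a i - a j) / Delta a b i j)

/-- `critPt` solves `Q_i = 0`, `q z ∂Q_i/∂z - p w ∂Q_i/∂w = 0`. -/
theorem critPt_spec {m : ℕ} (a b : Fin m → ℝ) (i : Fin m) (d : ℝ × ℝ)
    (ha : a i ≠ 0) (hb : b i ≠ 0) (hd : d.1 + d.2 ≠ 0) :
    factor (a i) (b i) (critPt a b i d).1 (critPt a b i d).2 = 0 ∧
      d.2 * (critPt a b i d).1 * (-a i) - d.1 * (critPt a b i d).2 * (-b i) = 0 := by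
  constructor
  · simp only [factor, critPt]
    field_simp
    ring
  · simp only [critPt]
    field_simp
    ring

/-- `crossPt` solves `Q_i = Q_j = 0`. -/
theorem crossPt_spec {m : ℕ} (a b : Fin m → ℝ) (i j : Fin m) (h : Delta a b i j ≠ 0) :
    factor (a i) (b i) (crossPt a b i j).1 (crossPt a b i j).2 = 0 ∧
      factor (a j) (b j) (crossPt a b i j).1 (crossPt a b i j).2 = 0 := by
  simp only [factor, crossPt]
  constructor <;> field_simp <;> simp only [Delta] <;> ring

/-- The cone `K_i`: the directions `(p, q)` in the closed quadrant for which `z ^ p w ^ q` attains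
both its maximum over `M` and its maximum over the line `Q_i = 0` at `(z_i, w_i)`. -/
def coneK {m : ℕ} (a b : Fin m → ℝ) (i : Fin m) : Set (ℝ × ℝ) :=
  {d | 0 ≤ d.1 ∧ 0 ≤ d.2 ∧ critPt a b i d ∈ polygon a b ∩ posLine a b i ∧
    IsMaxOn (monomial d) (polygon a b) (critPt a b i d) ∧
    IsMaxOn (monomial d) (posLine a b i) (critPt a b i d)}

/-- The cone `Ω_{ij}`: the directions `(p, q)` in the closed quadrant for which `z ^ p w ^ q`
attains its maximum over `M` at `(z_{ij}, w_{ij})`. -/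
def coneOmega {m : ℕ} (a b : Fin m → ℝ) (i j : Fin m) : Set (ℝ × ℝ) :=
  {d | 0 ≤ d.1 ∧ 0 ≤ d.2 ∧ crossPt a b i j ∈ polygon a b ∧
    IsMaxOn (monomial d) (polygon a b) (crossPt a b i j)}

/-- The direction of the `(p, q)`-diagonal as a point of `ℝ²`. -/
def dir (p q : ℕ) : ℝ × ℝ := ((p : ℝ), (q : ℝ))

/-- The numbering of the lines: those that carry sides of `M` are the first `r` ones, and along
them `a_i / b_i` increases. -/
structure SidesFirst {m : ℕ} (a b : Fin m → ℝ) (r : ℕ) : Prop where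
  le : r ≤ m
  side_iff : ∀ i : Fin m, IsSide a b i ↔ i.val < r
  increasing : ∀ i j : Fin m, i < j → j.val < r → a i / b i < a j / b j

end LinearPoles

end

noncomputable section

namespace LinearPoles

/-! All Taylor coefficients involved are nonnegative. One or two lines are singled out, with
coefficients `H`, and the remaining lines have coefficients `e`; then `f` is the Cauchy product of
`e` and `H` (`taylorCoeff_eq_conv`). If `H(n - u) / H(n)` tends to `P^u` along the diagonal under a
summable majorant, dominated convergence (`tendsto_conv_diagonal`) shows that `f` behaves like `H`
times the value at `P` of the product of the other `1 / Q_k`.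

Inside `K_i` a single line is taken out. Its coefficients are binomial, so Stirling's formula gives
the factor `1 / √k`, and the ratios converge to powers of the critical point. The majorant needs a
slightly enlarged point `(1 + δ) P`, available because the other factors are strictly positive at
`P`.

Inside `Ω_{i,i+1}` two lines are taken out. At their common point the normalised coefficient of `1 /
(Q_i Q_j)` is a difference of two negative binomial distribution functions divided by `Δ`
(`conv_linCoeff_eq_negBinCdf`). Chernoff bounds send one to `0` and the other to `1`, so the limit
is `-1 / Δ`, and the remaining product at the vertex is `A_{ij}`.

Partial fractions rest on a linear relation with nonzero constant term between any three of the
`Q_i`. For the covering statement, a maximum of the monomial over the compact polygon lies on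
exactly one line (giving `K_i`) or on two with consecutive indices (giving `Ω`). The cones are cut
out by linear inequalities, so only finitely many rays can carry boundary directions. -/

theorem hasSum_of_eq {ι α : Type*} [AddCommMonoid α] [TopologicalSpace α] {f g : ι → α} {s t : α}
    (h : HasSum f s) (hg : ∀ i, g i = f i) (ht : t = s) : HasSum g t := by
  rw [ht, funext hg]; exact h

/-! ### Double power series: Cauchy products and uniqueness of coefficients. -/

/-- The monomial `z ^ x * w ^ y` with exponent `n = (x, y)`. -/
def bimon {R : Type*} [CommSemiring R] (P : R × R) (n : ℕ × ℕ) : R := P.1 ^ n.1 * P.2 ^ n.2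

theorem bimon_add {R : Type*} [CommSemiring R] (P : R × R) (m n : ℕ × ℕ) :
    bimon P (m + n) = bimon P m * bimon P n := by
  simp only [bimon, Prod.fst_add, Prod.snd_add, pow_add]; ring

theorem bimon_ofReal (P : ℝ × ℝ) (n : ℕ × ℕ) :
    bimon ((P.1 : ℂ), (P.2 : ℂ)) n = (bimon P n : ℝ) := by
  simp [bimon]

theorem bimon_pos {P : ℝ × ℝ} (h₁ : 0 < P.1) (h₂ : 0 < P.2) (n : ℕ × ℕ) : 0 < bimon P n :=
  mul_pos (pow_pos h₁ _) (pow_pos h₂ _)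

/-- The Cauchy product of two double sequences. -/
def conv {R : Type*} [CommSemiring R] (f g : ℕ × ℕ → R) (n : ℕ × ℕ) : R :=
  ∑ u ∈ Finset.Iic n, f u * g (n - u)

theorem conv_nonneg {f g : ℕ × ℕ → ℝ} (hf : ∀ n, 0 ≤ f n) (hg : ∀ n, 0 ≤ g n) (n : ℕ × ℕ) :
    0 ≤ conv f g n :=
  Finset.sum_nonneg fun _ _ => mul_nonneg (hf _) (hg _)

theorem ofReal_conv (f g : ℕ × ℕ → ℝ) (n : ℕ × ℕ) :
    ((conv f g n : ℝ) : ℂ) = conv (fun k => (f k : ℂ)) (fun k => (g k : ℂ)) n := by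
  simp [conv]

/-- The injection `(u, v) ↦ (u + v, u)` has image `{(n, u) | u ≤ n}`. Extending by zero off this
image and summing over `u` for fixed `n` gives the finite inner sums. -/
theorem hasSum_conv_aux {F : (ℕ × ℕ) × (ℕ × ℕ) → ℂ} {S : ℂ} (h : HasSum F S) :
    HasSum (fun n => ∑ u ∈ Finset.Iic n, F (u, n - u)) S := by
  let φ : (ℕ × ℕ) × (ℕ × ℕ) → (ℕ × ℕ) × (ℕ × ℕ) := fun x => (x.1 + x.2, x.1)
  have hφ : Function.Injective φ := by
    rintro ⟨u, v⟩ ⟨u', v'⟩ h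
    simp only [φ, Prod.mk.injEq] at h
    obtain ⟨h₁, rfl⟩ := h
    rw [add_left_cancel h₁]
  let Φ : (ℕ × ℕ) × (ℕ × ℕ) → ℂ := fun x => if x.2 ≤ x.1 then F (x.2, x.1 - x.2) else 0
  have hΦ : HasSum Φ S := by
    rw [← hφ.hasSum_iff]
    · refine hasSum_of_eq h (fun x => ?_) rfl
      have h1 : x.1 ≤ x.1 + x.2 := le_self_add
      have h2 : x.1 + x.2 - x.1 = x.2 := add_tsub_cancel_left _ _
      simp only [Φ, φ, Function.comp, if_pos h1, h2]
    · rintro ⟨n, u⟩ hx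
      refine if_neg fun hle => hx ⟨(u, n - u), ?_⟩
      simp only [φ, Prod.mk.injEq, and_true]
      exact add_tsub_cancel_of_le hle
  refine hΦ.prod_fiberwise fun n => ?_
  have h0 : ∀ u ∉ Finset.Iic n, Φ (n, u) = 0 := fun u hu =>
    if_neg fun hle => hu (Finset.mem_Iic.2 hle)
  refine hasSum_of_eq (hasSum_sum_of_ne_finset_zero h0) (fun _ => rfl) ?_
  refine Finset.sum_congr rfl fun u hu => ?_
  exact (if_pos (Finset.mem_Iic.1 hu)).symm

theorem hasSum_conv {f g : ℕ × ℕ → ℂ} {P : ℂ × ℂ} {S T : ℂ}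
    (hf : HasSum (fun n => f n * bimon P n) S) (hg : HasSum (fun n => g n * bimon P n) T) :
    HasSum (fun n => conv f g n * bimon P n) (S * T) := by
  have hfn : Summable fun n => ‖f n * bimon P n‖ := hf.summable.norm
  have hgn : Summable fun n => ‖g n * bimon P n‖ := hg.summable.norm
  have hs := summable_mul_of_summable_norm (f := fun n => f n * bimon P n)
    (g := fun n => g n * bimon P n) hfn hgn
  refine hasSum_of_eq (hasSum_conv_aux (hf.mul hg hs))
    (fun n => ?_) rfl
  rw [conv, Finset.sum_mul]
  refine Finset.sum_congr rfl fun u hu => ?_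
  rw [mul_mul_mul_comm, ← bimon_add, add_tsub_cancel_of_le (Finset.mem_Iic.1 hu)]

theorem coeff_eq_zero_of_hasSum {c : ℕ → ℂ} (h : ∀ᶠ z : ℂ in 𝓝 0, HasSum (fun n => c n * z ^ n) 0)
    (n : ℕ) : c n = 0 := by
  have h' : HasFPowerSeriesAt (0 : ℂ → ℂ) (FormalMultilinearSeries.ofScalars ℂ c) 0 := by
    rw [hasFPowerSeriesAt_iff]
    filter_upwards [h] with z hz
    simpa [FormalMultilinearSeries.coeff_ofScalars, mul_comm] using hz
  have := h'.eq_zero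
  have h2 := congrArg (fun p => FormalMultilinearSeries.coeff p n) this
  simp only [FormalMultilinearSeries.coeff_ofScalars] at h2
  rw [h2]; rfl

/-- One-variable uniqueness is used twice: for fixed `w` the sums over `y` are the coefficients of a
power series in `z`, hence vanish, and each of them is in turn a power series in `w`. -/
theorem dcoeff_eq_zero_of_hasSum {c : ℕ × ℕ → ℂ}
    (h : ∀ᶠ P : ℂ × ℂ in 𝓝 0, HasSum (fun n => c n * bimon P n) 0) (n : ℕ × ℕ) : c n = 0 := by
  rw [show (0 : ℂ × ℂ) = (0, 0) from rfl, nhds_prod_eq] at h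
  obtain ⟨pa, hpa, pb, hpb, hP⟩ := Filter.eventually_prod_iff.1 h
  have hfib : ∀ w, pb w → ∀ x, Summable (fun y => c (x, y) * w ^ y) ∧
      (∑' y, c (x, y) * w ^ y) = 0 := by
    intro w hw
    have hs : ∀ x, Summable (fun y => c (x, y) * w ^ y) := by
      -- A nonzero `z` is needed to cancel `z ^ x` from the summable row.
      obtain ⟨z, hz, hz0⟩ : ∃ z, pa z ∧ z ≠ 0 := by
        have h1 : ∀ᶠ z in 𝓝[≠] (0 : ℂ), pa z := hpa.filter_mono nhdsWithin_le_nhds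
        exact (h1.and self_mem_nhdsWithin).exists
      intro x
      have := (hP hz hw).summable.prod_factor x
      have h2 := this.mul_left ((z ^ x)⁻¹)
      refine h2.congr fun y => ?_
      simp only [bimon]
      field_simp
    intro x
    refine ⟨hs x, ?_⟩
    refine coeff_eq_zero_of_hasSum (c := fun x => ∑' y, c (x, y) * w ^ y) ?_ x
    filter_upwards [hpa] with z hz
    refine (hP hz hw).prod_fiberwise fun x => ?_
    have := (hs x).hasSum.mul_right (z ^ x)
    refine hasSum_of_eq this (fun y => ?_) rfl
    simp only [bimon]
    ring
  refine coeff_eq_zero_of_hasSum (c := fun y => c (n.1, y)) ?_ n.2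
  filter_upwards [hpb] with w hw
  rw [← (hfib w hw n.1).2]
  exact (hfib w hw n.1).1.hasSum

theorem dcoeff_unique {c d : ℕ × ℕ → ℂ} {F : ℂ × ℂ → ℂ}
    (hc : ∀ᶠ P : ℂ × ℂ in 𝓝 0, HasSum (fun n => c n * bimon P n) (F P))
    (hd : ∀ᶠ P : ℂ × ℂ in 𝓝 0, HasSum (fun n => d n * bimon P n) (F P)) : c = d := by
  funext n
  rw [← sub_eq_zero]
  refine dcoeff_eq_zero_of_hasSum (c := fun n => c n - d n) ?_ n
  filter_upwards [hc, hd] with P h₁ h₂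
  simpa [sub_mul] using h₁.sub h₂

/-! ### Taylor coefficients of products of linear factors. -/

/-- The Taylor coefficients of `1 / (1 - α z - β w)`. -/
def linCoeff (α β : ℝ) (n : ℕ × ℕ) : ℝ := (n.1 + n.2).choose n.2 * α ^ n.1 * β ^ n.2

theorem linCoeff_nonneg {α β : ℝ} (hα : 0 ≤ α) (hβ : 0 ≤ β) (n : ℕ × ℕ) :
    0 ≤ linCoeff α β n := by
  unfold linCoeff; positivity

/-- Summing over the exponent of `r` gives `s ^ k / (1 - r) ^ (k + 1)`, and what remains is a
geometric series in `s / (1 - r)`. With norms in place of `r`, `s` the same computation gives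
absolute summability, since `‖s‖ / (1 - ‖r‖) < 1` is the hypothesis. -/
theorem hasSum_choose_two {r s : ℂ} (h : ‖r‖ + ‖s‖ < 1) :
    HasSum (fun n : ℕ × ℕ => ((n.2 + n.1).choose n.1 : ℂ) * r ^ n.2 * s ^ n.1)
      (1 / (1 - r - s)) := by
  have hr : ‖r‖ < 1 := lt_of_le_of_lt (le_add_of_nonneg_right (norm_nonneg s)) h
  have hr' : ‖(‖r‖ : ℝ)‖ < 1 := by simpa using hr
  have inner : ∀ k : ℕ, HasSum (fun n : ℕ => ((n + k).choose k : ℝ) * ‖r‖ ^ n * ‖s‖ ^ k)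
      (1 / (1 - ‖r‖) ^ (k + 1) * ‖s‖ ^ k) := fun k =>
    (hasSum_choose_mul_geometric_of_norm_lt_one k hr').mul_right _
  have hgeom : ∀ k : ℕ, 1 / (1 - ‖r‖) ^ (k + 1) * ‖s‖ ^ k =
      (‖s‖ / (1 - ‖r‖)) ^ k * (1 / (1 - ‖r‖)) := by
    intro k
    have : 1 - ‖r‖ ≠ 0 := by linarith
    rw [div_pow, pow_succ]; field_simp
  have hsum : Summable (fun n : ℕ × ℕ => ((n.2 + n.1).choose n.1 : ℂ) * r ^ n.2 * s ^ n.1) := by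
    rw [← summable_norm_iff]
    simp only [norm_mul, norm_pow, Complex.norm_natCast]
    rw [summable_prod_of_nonneg (fun _ => by positivity)]
    refine ⟨fun k => (inner k).summable, ?_⟩
    simp only [(inner _).tsum_eq, hgeom]
    refine (summable_geometric_of_lt_one ?_ ?_).mul_right _
    · exact div_nonneg (norm_nonneg _) (by linarith)
    · rw [div_lt_one (by linarith)]; linarith
  have hone : (1 : ℂ) - r ≠ 0 := by
    intro h0
    have : r = 1 := (sub_eq_zero.1 h0).symm
    simp [this] at hr
  have hlt : ‖s / (1 - r)‖ < 1 := by
    rw [norm_div, div_lt_one (norm_pos_iff.2 hone)]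
    have := norm_sub_norm_le (1 : ℂ) r
    simp at this
    linarith
  have h2 := hsum.hasSum.prod_fiberwise fun k =>
    (hasSum_choose_mul_geometric_of_norm_lt_one k hr).mul_right (s ^ k)
  have h3 : HasSum (fun k : ℕ => 1 / (1 - r) ^ (k + 1) * s ^ k) (1 / (1 - r - s)) := by
    have := (hasSum_geometric_of_norm_lt_one hlt).mul_right (1 / (1 - r))
    refine hasSum_of_eq this (fun k => ?_) ?_
    · rw [div_pow, pow_succ]; field_simp
    · have h4 : (1 : ℂ) - s / (1 - r) ≠ 0 := by
        intro h0
        have : s / (1 - r) = 1 := (sub_eq_zero.1 h0).symm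
        simp [this] at hlt
      have h5 : (1 - s / (1 - r)) * (1 - r) = 1 - r - s := by field_simp
      rw [← h5, one_div, one_div, mul_inv]
  rw [← h2.unique h3]
  exact hsum.hasSum

theorem hasSum_linCoeff {α β : ℝ} (hα : 0 ≤ α) (hβ : 0 ≤ β) {P : ℂ × ℂ}
    (h : α * ‖P.1‖ + β * ‖P.2‖ < 1) :
    HasSum (fun n => (linCoeff α β n : ℂ) * bimon P n) (1 / factor (α : ℂ) (β : ℂ) P.1 P.2) := by
  have h1 : ‖(α : ℂ) * P.1‖ + ‖(β : ℂ) * P.2‖ < 1 := by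
    simpa [norm_mul, abs_of_nonneg hα, abs_of_nonneg hβ] using h
  have h2 := (Equiv.prodComm ℕ ℕ).hasSum_iff.2 (hasSum_choose_two h1)
  refine hasSum_of_eq h2 (fun n => ?_) rfl
  simp only [linCoeff, bimon, Function.comp, Equiv.prodComm_apply, Prod.fst_swap, Prod.snd_swap,
    mul_pow]
  push_cast
  ring

/-- `e` is a nonnegative double sequence whose generating function is `∏_{i ∈ s} 1 / Q_i`
on the polydisc where the geometric series converge. -/
structure IsProdCoeff {ι : Type*} (a b : ι → ℝ) (s : Finset ι) (e : ℕ × ℕ → ℝ) : Prop where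
  nonneg : ∀ n, 0 ≤ e n
  hasSum : ∀ P : ℂ × ℂ, (∀ i ∈ s, a i * ‖P.1‖ + b i * ‖P.2‖ < 1) →
    HasSum (fun n => (e n : ℂ) * bimon P n) (∏ i ∈ s, 1 / factor (a i : ℂ) (b i : ℂ) P.1 P.2)

theorem exists_isProdCoeff {ι : Type*} [DecidableEq ι] {a b : ι → ℝ} (ha : ∀ i, 0 ≤ a i)
    (hb : ∀ i, 0 ≤ b i) (s : Finset ι) : ∃ e, IsProdCoeff a b s e := by
  induction s using Finset.induction_on with
  | empty =>
    refine ⟨fun n => if n = 0 then 1 else 0, fun n => by positivity, fun P _ => ?_⟩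
    have := hasSum_ite_eq (0 : ℕ × ℕ) (1 : ℂ)
    refine hasSum_of_eq this (fun n => ?_) (by simp)
    by_cases h : n = 0 <;> simp [h, bimon]
  | insert i s hi ih =>
    obtain ⟨e, he⟩ := ih
    refine ⟨conv (linCoeff (a i) (b i)) e, conv_nonneg (linCoeff_nonneg (ha i) (hb i)) he.nonneg,
      fun P hP => ?_⟩
    have := hasSum_conv (hasSum_linCoeff (ha i) (hb i) (hP i (Finset.mem_insert_self _ _)))
      (he.hasSum P fun j hj => hP j (Finset.mem_insert_of_mem hj))
    rw [Finset.prod_insert hi]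
    exact hasSum_of_eq this (fun n => by rw [ofReal_conv]) rfl

/-- In the closed quadrant, `Q_i > 0` is the very condition for the polydisc of convergence. Through
this lemma, positivity of the other factors at a point becomes summability there. -/
theorem IsProdCoeff.hasSum_real {ι : Type*} {a b : ι → ℝ} {s : Finset ι} {e : ℕ × ℕ → ℝ}
    (he : IsProdCoeff a b s e) {P : ℝ × ℝ} (h₁ : 0 ≤ P.1) (h₂ : 0 ≤ P.2)
    (hP : ∀ i ∈ s, 0 < factor (a i) (b i) P.1 P.2) :
    HasSum (fun n => e n * bimon P n) (∏ i ∈ s, 1 / factor (a i) (b i) P.1 P.2) := by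
  have := he.hasSum ((P.1 : ℂ), (P.2 : ℂ)) fun i hi => by
    have := hP i hi
    simp only [factor, Complex.norm_real, Real.norm_eq_abs, abs_of_nonneg h₁,
      abs_of_nonneg h₂] at this ⊢
    linarith
  rw [← Complex.hasSum_ofReal]
  refine hasSum_of_eq this (fun n => by rw [bimon_ofReal]; push_cast; rfl) ?_
  simp [factor]

theorem eventually_small {m : ℕ} (a b : Fin m → ℝ) :
    ∀ᶠ P : ℂ × ℂ in 𝓝 0, ∀ i, a i * ‖P.1‖ + b i * ‖P.2‖ < 1 := by
  rw [eventually_all]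
  intro i
  have : Continuous fun P : ℂ × ℂ => a i * ‖P.1‖ + b i * ‖P.2‖ := by fun_prop
  exact this.continuousAt.eventually_lt continuousAt_const (by simp)

/-- The Taylor coefficients of `F` split along a decomposition of the set of lines. -/
theorem taylorCoeff_eq_conv {m : ℕ} {a b : Fin m → ℝ} {f : ℕ → ℕ → ℂ}
    (hf : IsTaylorCoeff (ratFun a b) f) {s : Finset (Fin m)} {e g : ℕ × ℕ → ℝ}
    (he : IsProdCoeff a b sᶜ e) (hg : IsProdCoeff a b s g) (x y : ℕ) :
    f x y = (conv e g (x, y) : ℝ) := by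
  have key : (fun n : ℕ × ℕ => f n.1 n.2) = fun n => ((conv e g n : ℝ) : ℂ) := by
    refine dcoeff_unique (F := ratFun a b) ?_ ?_
    · filter_upwards [hf] with P hP
      exact hasSum_of_eq hP (fun n => by simp only [bimon]; ring) rfl
    · filter_upwards [eventually_small a b] with P hP
      refine hasSum_of_eq (hasSum_conv (he.hasSum P fun i _ => hP i)
        (hg.hasSum P fun i _ => hP i)) (fun n => by rw [ofReal_conv]) ?_
      rw [Finset.prod_compl_mul_prod, ratFun]
      simp
  exact congrFun key (x, y)

theorem isProdCoeff_linCoeff {ι : Type*} {a b : ι → ℝ} (ha : ∀ i, 0 ≤ a i)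
    (hb : ∀ i, 0 ≤ b i) (i : ι) : IsProdCoeff a b {i} (linCoeff (a i) (b i)) :=
  ⟨linCoeff_nonneg (ha i) (hb i), fun P hP => by
    simpa using hasSum_linCoeff (ha i) (hb i) (hP i (by simp))⟩

theorem isProdCoeff_conv_linCoeff {ι : Type*} [DecidableEq ι] {a b : ι → ℝ} (ha : ∀ i, 0 ≤ a i)
    (hb : ∀ i, 0 ≤ b i) {i j : ι} (hij : i ≠ j) :
    IsProdCoeff a b {i, j} (conv (linCoeff (a i) (b i)) (linCoeff (a j) (b j))) :=
  ⟨conv_nonneg (linCoeff_nonneg (ha i) (hb i)) (linCoeff_nonneg (ha j) (hb j)), fun P hP => by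
    rw [Finset.prod_pair hij]
    exact hasSum_of_eq (hasSum_conv (hasSum_linCoeff (ha i) (hb i) (hP i (by simp)))
      (hasSum_linCoeff (ha j) (hb j) (hP j (by simp)))) (fun n => by rw [ofReal_conv]) rfl⟩

/-! ### Partial fractions -/

theorem factor_crossPt_mul {m : ℕ} (a b : Fin m → ℝ) {i j : Fin m} (k : Fin m)
    (h : Delta a b i j ≠ 0) :
    factor (a k) (b k) (crossPt a b i j).1 (crossPt a b i j).2 * Delta a b i j =
      Delta a b i j + Delta a b j k + Delta a b k i := by
  simp only [factor, crossPt]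
  field_simp
  simp only [Delta]
  ring

theorem mem_complexLine_ofReal {m : ℕ} (a b : Fin m → ℝ) (i : Fin m) (P : ℝ × ℝ) :
    ((P.1 : ℂ), (P.2 : ℂ)) ∈ complexLine a b i ↔ factor (a i) (b i) P.1 P.2 = 0 := by
  simp only [complexLine, factor, Set.mem_ofPred_eq]
  norm_cast

/-- No three lines have a common real point. -/
theorem GeneralPosition.factor_ne_zero {m : ℕ} {a b : Fin m → ℝ} (h : GeneralPosition a b)
    {i j k : Fin m} (hij : i ≠ j) (hki : k ≠ i) (hkj : k ≠ j) {P : ℝ × ℝ}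
    (hi : factor (a i) (b i) P.1 P.2 = 0) (hj : factor (a j) (b j) P.1 P.2 = 0) :
    factor (a k) (b k) P.1 P.2 ≠ 0 := by
  intro hk
  have hmem : ((P.1 : ℂ), (P.2 : ℂ)) ∈
      complexLine a b i ∩ complexLine a b j ∩ complexLine a b k :=
    ⟨⟨(mem_complexLine_ofReal a b i P).2 hi, (mem_complexLine_ofReal a b j P).2 hj⟩,
      (mem_complexLine_ofReal a b k P).2 hk⟩
  rw [h.triple i j k hij hkj.symm hki.symm] at hmem
  exact hmem

/-- The sum is `Δ_{ij}` times the value of `Q_k` at the common point of lines `i` and `j`, so it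
vanishes only for concurrent lines. -/
theorem GeneralPosition.sum_Delta_ne_zero {m : ℕ} {a b : Fin m → ℝ} (h : GeneralPosition a b)
    {i j k : Fin m} (hij : i ≠ j) (hki : k ≠ i) (hkj : k ≠ j) :
    Delta a b i j + Delta a b j k + Delta a b k i ≠ 0 := by
  have hd := h.pair i j hij
  have hs := crossPt_spec a b i j hd
  rw [← factor_crossPt_mul a b k hd]
  exact mul_ne_zero (h.factor_ne_zero hij hki hkj hs.1 hs.2) hd

/-- The product of the factors `Q_k` over a finite set of lines, as a function on `ℂ²`. -/
def prodFactor {m : ℕ} (a b : Fin m → ℝ) (s : Finset (Fin m)) (P : ℂ × ℂ) : ℂ :=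
  ∏ k ∈ s, factor (a k : ℂ) (b k : ℂ) P.1 P.2

/-- The real span of the products of all but two of the factors. -/
def pairSpan {m : ℕ} (a b : Fin m → ℝ) (s : Finset (Fin m)) : Submodule ℝ (ℂ × ℂ → ℂ) :=
  Submodule.span ℝ {v | ∃ i ∈ s, ∃ j ∈ s, i ≠ j ∧ v = prodFactor a b ((s.erase i).erase j)}

/-- The relation `Δ_{ij} Q_k + Δ_{jk} Q_i + Δ_{ki} Q_j = D`, with `D` the nonzero sum of the three
determinants, is multiplied by the product over `t` and divided by `D`. -/
theorem prodFactor_mem_pairSpan_insert {m : ℕ} {a b : Fin m → ℝ} (h : GeneralPosition a b)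
    {s : Finset (Fin m)} {i j k : Fin m} (hi : i ∈ s) (hj : j ∈ s) (hij : i ≠ j) (hk : k ∉ s) :
    prodFactor a b ((s.erase i).erase j) ∈ pairSpan a b (insert k s) := by
  have hki : k ≠ i := fun h => hk (h ▸ hi)
  have hkj : k ≠ j := fun h => hk (h ▸ hj)
  set t := (s.erase i).erase j with ht
  have hkt : k ∉ t := fun h => hk (Finset.mem_of_mem_erase (Finset.mem_of_mem_erase h))
  have hit : i ∉ t := by simp [ht]
  have hjt : j ∉ t := by simp [ht]
  have e1 : ((insert k s).erase i).erase j = insert k t := by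
    ext x; simp only [ht, Finset.mem_erase, Finset.mem_insert]; grind
  have e2 : ((insert k s).erase j).erase k = insert i t := by
    ext x; simp only [ht, Finset.mem_erase, Finset.mem_insert]; grind
  have e3 : ((insert k s).erase k).erase i = insert j t := by
    ext x; simp only [ht, Finset.mem_erase, Finset.mem_insert]; grind
  have hD := h.sum_Delta_ne_zero hij hki hkj
  set D := Delta a b i j + Delta a b j k + Delta a b k i with hDdef
  have m1 : prodFactor a b (insert k t) ∈ pairSpan a b (insert k s) :=
    Submodule.subset_span ⟨i, by simp [hi], j, by simp [hj], hij, by rw [e1]⟩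
  have m2 : prodFactor a b (insert i t) ∈ pairSpan a b (insert k s) :=
    Submodule.subset_span ⟨j, by simp [hj], k, by simp, hkj.symm, by rw [e2]⟩
  have m3 : prodFactor a b (insert j t) ∈ pairSpan a b (insert k s) :=
    Submodule.subset_span ⟨k, by simp, i, by simp [hi], hki, by rw [e3]⟩
  have hcomb : prodFactor a b t = (Delta a b i j / D) • prodFactor a b (insert k t) +
      (Delta a b j k / D) • prodFactor a b (insert i t) +
      (Delta a b k i / D) • prodFactor a b (insert j t) := by
    funext P
    simp only [Pi.add_apply, Pi.smul_apply, prodFactor, Finset.prod_insert hkt,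
      Finset.prod_insert hit, Finset.prod_insert hjt, Complex.real_smul]
    have hD' : (D : ℂ) ≠ 0 := by exact_mod_cast hD
    generalize (∏ x ∈ t, factor (a x : ℂ) (b x : ℂ) P.1 P.2) = q
    push_cast
    field_simp
    rw [hDdef]
    simp only [factor, Delta]
    push_cast
    ring
  rw [hcomb]
  exact add_mem (add_mem (Submodule.smul_mem _ _ m1) (Submodule.smul_mem _ _ m2))
    (Submodule.smul_mem _ _ m3)

theorem one_mem_pairSpan {m : ℕ} {a b : Fin m → ℝ} (h : GeneralPosition a b)
    {s : Finset (Fin m)} (hs : 2 ≤ s.card) : (fun _ => 1) ∈ pairSpan a b s := by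
  induction s using Finset.induction_on with
  | empty => simp at hs
  | insert k s hk ih =>
    rw [Finset.card_insert_of_notMem hk] at hs
    -- The induction starts at two lines, where omitting both factors leaves the empty product `1`.
    by_cases hs1 : s.card = 1
    · obtain ⟨i, rfl⟩ := Finset.card_eq_one.1 hs1
      refine Submodule.subset_span ⟨k, by simp, i, by simp, by simpa using hk, ?_⟩
      have : ((insert k {i} : Finset (Fin m)).erase k).erase i = ∅ := by
        ext x; simp only [Finset.mem_erase, Finset.mem_insert, Finset.mem_singleton]; grind
      rw [this]; funext P; simp [prodFactor]
    · refine Submodule.span_le.2 ?_ (ih (by omega))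
      rintro v ⟨i, hi, j, hj, hij, rfl⟩
      exact prodFactor_mem_pairSpan_insert h hi hj hij hk

theorem exists_sum_prodFactor {m : ℕ} {a b : Fin m → ℝ} (h : GeneralPosition a b) (hm : 2 ≤ m) :
    ∃ A : Fin m → Fin m → ℝ, ∀ P : ℂ × ℂ, 1 = ∑ i, ∑ j ∈ Finset.Ioi i,
      (A i j : ℂ) * prodFactor a b ((Finset.univ.erase i).erase j) P := by
  have h1 := one_mem_pairSpan h (s := Finset.univ) (by simpa using hm)
  -- The family runs over all pairs and is zero unless `i < j`, so the span coefficients can be read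
  -- off as a function of two indices.
  let v : Fin m × Fin m → (ℂ × ℂ → ℂ) := fun x =>
    if x.1 < x.2 then prodFactor a b ((Finset.univ.erase x.1).erase x.2) else 0
  have h2 : pairSpan a b Finset.univ ≤ Submodule.span ℝ (Set.range v) := by
    refine Submodule.span_le.2 ?_
    rintro _ ⟨i, -, j, -, hij, rfl⟩
    rcases lt_or_gt_of_ne hij with hlt | hlt
    · exact Submodule.subset_span ⟨(i, j), if_pos hlt⟩
    · rw [Finset.erase_right_comm]
      exact Submodule.subset_span ⟨(j, i), if_pos hlt⟩
  obtain ⟨c, hc⟩ := (Submodule.mem_span_range_iff_exists_fun ℝ).1 (h2 h1)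
  refine ⟨fun i j => c (i, j), fun P => ?_⟩
  have h3 := congrFun hc P
  rw [Finset.sum_apply, Fintype.sum_prod_type] at h3
  rw [← h3]
  refine Finset.sum_congr rfl fun i _ => ?_
  rw [← Finset.filter_lt_eq_Ioi, Finset.sum_filter]
  refine Finset.sum_congr rfl fun j _ => ?_
  by_cases hij : i < j <;> simp [v, hij]

theorem isPartialFraction_of_sum_prodFactor {m : ℕ} {a b : Fin m → ℝ} {A : Fin m → Fin m → ℝ}
    (hA : ∀ P : ℂ × ℂ, 1 = ∑ i, ∑ j ∈ Finset.Ioi i,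
      (A i j : ℂ) * prodFactor a b ((Finset.univ.erase i).erase j) P) :
    IsPartialFraction a b A := by
  intro P hP
  have hne : ∀ i, factor (a i : ℂ) (b i : ℂ) P.1 P.2 ≠ 0 := hP
  rw [ratFun]
  nth_rewrite 1 [hA P]
  rw [Finset.sum_div]
  refine Finset.sum_congr rfl fun i _ => ?_
  rw [Finset.sum_div]
  refine Finset.sum_congr rfl fun j hj => ?_
  have hij : j ≠ i := (Finset.mem_Ioi.1 hj).ne'
  have hprod : ∏ k, factor (a k : ℂ) (b k : ℂ) P.1 P.2 = factor (a i : ℂ) (b i : ℂ) P.1 P.2 *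
      (factor (a j : ℂ) (b j : ℂ) P.1 P.2 *
        prodFactor a b ((Finset.univ.erase i).erase j) P) := by
    rw [prodFactor, Finset.mul_prod_erase _ (fun k => factor (a k : ℂ) (b k : ℂ) P.1 P.2)
      (Finset.mem_erase.2 ⟨hij, Finset.mem_univ j⟩),
      Finset.mul_prod_erase _ (fun k => factor (a k : ℂ) (b k : ℂ) P.1 P.2) (Finset.mem_univ i)]
  have h0 : prodFactor a b ((Finset.univ.erase i).erase j) P ≠ 0 :=
    Finset.prod_ne_zero_iff.2 fun k _ => hne k
  have := hne i
  have := hne j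
  rw [hprod]
  field_simp

/-- The coefficient `A_{ij}` is the reciprocal of the product of the other factors at the common
point of the two lines. -/
theorem partialFraction_coeff_eq {m : ℕ} {a b : Fin m → ℝ} (h : GeneralPosition a b)
    {A : Fin m → Fin m → ℝ}
    (hA : ∀ P : ℂ × ℂ, 1 = ∑ i, ∑ j ∈ Finset.Ioi i,
      (A i j : ℂ) * prodFactor a b ((Finset.univ.erase i).erase j) P)
    {i j : Fin m} (hij : i < j) :
    A i j = ∏ k ∈ ({i, j} : Finset (Fin m))ᶜ,
      1 / factor (a k) (b k) (crossPt a b i j).1 (crossPt a b i j).2 := by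
  have hd := h.pair i j hij.ne
  set P := crossPt a b i j with hP
  have hs := crossPt_spec a b i j hd
  have hset : (Finset.univ.erase i).erase j = ({i, j} : Finset (Fin m))ᶜ := by
    ext x; simp only [Finset.mem_erase, Finset.mem_compl, Finset.mem_insert,
      Finset.mem_singleton, Finset.mem_univ]; grind
  -- Omitting any other pair leaves `Q_i` or `Q_j` in the product, and both vanish at the crossing
  -- point; evaluation there isolates `A i j`.
  have hzero : ∀ i' j' : Fin m, i' < j' → ¬ (i' = i ∧ j' = j) →
      prodFactor a b ((Finset.univ.erase i').erase j') ((P.1 : ℂ), (P.2 : ℂ)) = 0 := by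
    intro i' j' hlt hne
    have : i ∈ (Finset.univ.erase i').erase j' ∨ j ∈ (Finset.univ.erase i').erase j' := by
      simp only [Finset.mem_erase, Finset.mem_univ]; grind
    rcases this with h | h
    · exact Finset.prod_eq_zero h ((mem_complexLine_ofReal a b i P).2 hs.1)
    · exact Finset.prod_eq_zero h ((mem_complexLine_ofReal a b j P).2 hs.2)
  have h1 := hA ((P.1 : ℂ), (P.2 : ℂ))
  rw [Finset.sum_eq_single i, Finset.sum_eq_single j] at h1
  · rw [hset] at h1
    have h2 : (1 : ℝ) = A i j * ∏ k ∈ ({i, j} : Finset (Fin m))ᶜ, factor (a k) (b k) P.1 P.2 := by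
      have : ((1 : ℝ) : ℂ) = ((A i j * ∏ k ∈ ({i, j} : Finset (Fin m))ᶜ,
          factor (a k) (b k) P.1 P.2 : ℝ) : ℂ) := by
        rw [Complex.ofReal_one, h1]
        simp [prodFactor, factor]
      exact_mod_cast this
    rw [Finset.prod_div_distrib, Finset.prod_const_one]
    exact eq_one_div_of_mul_eq_one_left h2.symm
  · intro j' hj' hne
    rw [hzero i j' (Finset.mem_Ioi.1 hj') (by simp [hne]), mul_zero]
  · intro hj; exact absurd (Finset.mem_Ioi.2 hij) hj
  · intro i' _ hne
    refine Finset.sum_eq_zero fun j' hj' => ?_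
    rw [hzero i' j' (Finset.mem_Ioi.1 hj') (by simp [hne]), mul_zero]
  · intro hi; exact absurd (Finset.mem_univ i) hi

/-! ### Dominated convergence along a diagonal and the coefficients of one linear factor. -/

/-- Dominated convergence for a Cauchy product along a diagonal. -/
theorem tendsto_conv_diagonal {e H : ℕ × ℕ → ℝ} {p q : ℕ} {N : ℕ → ℝ} {P P' : ℝ × ℝ} {L C : ℝ}
    (he : ∀ n, 0 ≤ e n) (hC : 0 ≤ C) (h₁ : 0 < P'.1) (h₂ : 0 < P'.2)
    (hsum : Summable fun n => e n * bimon P' n)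
    (hlim : ∀ u : ℕ × ℕ, Tendsto (fun k : ℕ => H ((k * p, k * q) - u) * N k) atTop
      (𝓝 (L * bimon P u)))
    (hbd : ∀ᶠ k : ℕ in atTop, ∀ u : ℕ × ℕ, u ≤ (k * p, k * q) →
      |H ((k * p, k * q) - u) * N k| ≤ C * bimon P' u)
    (hp : 0 < p) (hq : 0 < q) :
    Tendsto (fun k : ℕ => conv e H (k * p, k * q) * N k) atTop
      (𝓝 (L * ∑' u, e u * bimon P u)) := by
  -- The cutoff by zero turns the growing finite sums into series over a fixed index set.
  let F : ℕ → ℕ × ℕ → ℝ := fun k u =>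
    if u ≤ (k * p, k * q) then e u * (H ((k * p, k * q) - u) * N k) else 0
  have hF : ∀ k, conv e H (k * p, k * q) * N k = ∑' u, F k u := by
    intro k
    rw [tsum_eq_sum (s := Finset.Iic (k * p, k * q))]
    · rw [conv, Finset.sum_mul]
      refine Finset.sum_congr rfl fun u hu => ?_
      simp only [F]
      rw [if_pos (Finset.mem_Iic.1 hu), mul_assoc]
    · intro u hu
      exact if_neg fun h => hu (Finset.mem_Iic.2 h)
  simp only [hF]
  rw [← tsum_mul_left]
  refine tendsto_tsum_of_dominated_convergence (hsum.mul_left C) (fun u => ?_) ?_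
  · have h1 := (hlim u).const_mul (e u)
    have h2 : e u * (L * bimon P u) = L * (e u * bimon P u) := by ring
    rw [h2] at h1
    refine h1.congr' ?_
    filter_upwards [eventually_ge_atTop u.1, eventually_ge_atTop u.2] with k hk1 hk2
    have : u ≤ (k * p, k * q) :=
      ⟨hk1.trans (Nat.le_mul_of_pos_right _ hp), hk2.trans (Nat.le_mul_of_pos_right _ hq)⟩
    simp only [F]
    rw [if_pos this]
  · filter_upwards [hbd] with k hk u
    simp only [F]
    split_ifs with hu
    · rw [Real.norm_eq_abs, abs_mul, abs_of_nonneg (he u)]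
      calc e u * |H ((k * p, k * q) - u) * N k| ≤ e u * (C * bimon P' u) :=
            mul_le_mul_of_nonneg_left (hk u hu) (he u)
        _ = C * (e u * bimon P' u) := by ring
    · rw [norm_zero]
      exact mul_nonneg hC (mul_nonneg (he u) (bimon_pos h₁ h₂ u).le)

theorem linCoeff_pos {α β : ℝ} (hα : 0 < α) (hβ : 0 < β) (n : ℕ × ℕ) : 0 < linCoeff α β n := by
  have : 0 < (n.1 + n.2).choose n.2 := Nat.choose_pos (Nat.le_add_left _ _)
  unfold linCoeff; positivity

/-- The left side is one term of the binomial expansion of `(α P.1 + β P.2) ^ (n.1 + n.2) = 1`. -/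
theorem linCoeff_mul_bimon_le_one {α β : ℝ} (hα : 0 ≤ α) (hβ : 0 ≤ β) {P : ℝ × ℝ}
    (h₁ : 0 ≤ P.1) (h₂ : 0 ≤ P.2) (hP : α * P.1 + β * P.2 = 1) (n : ℕ × ℕ) :
    linCoeff α β n * bimon P n ≤ 1 := by
  have h := add_pow (β * P.2) (α * P.1) (n.1 + n.2)
  rw [add_comm, hP, one_pow] at h
  rw [h]
  have := Finset.single_le_sum (s := Finset.range (n.1 + n.2 + 1))
    (f := fun m => (β * P.2) ^ m * (α * P.1) ^ (n.1 + n.2 - m) * ((n.1 + n.2).choose m : ℝ))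
    (fun m _ => by positivity) (Finset.mem_range.2 (by omega : n.2 < n.1 + n.2 + 1))
  refine le_trans (le_of_eq ?_) this
  simp only [linCoeff, bimon, Nat.add_sub_cancel, mul_pow]
  ring

theorem linCoeff_eq_factorial (α β : ℝ) (x y : ℕ) :
    linCoeff α β (x, y) * (x.factorial * y.factorial) =
      (x + y).factorial * (α ^ x * β ^ y) := by
  have h : (((x + y).choose y * x.factorial * y.factorial : ℕ) : ℝ) = (x + y).factorial := by
    rw [← Nat.add_choose_mul_factorial_mul_factorial x y]
  push_cast at h
  rw [← h, linCoeff]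
  ring

/-- A shift of the index replaces each of the three factorials by itself over a falling factorial;
the resulting ratio is written without division. -/
theorem linCoeff_sub {α β : ℝ} {x y : ℕ} {u : ℕ × ℕ} (hu : u ≤ (x, y)) :
    linCoeff α β ((x, y) - u) * ((α ^ u.1 * β ^ u.2) * (x + y).descFactorial (u.1 + u.2)) =
      linCoeff α β (x, y) * (x.descFactorial u.1 * y.descFactorial u.2) := by
  obtain ⟨s, t⟩ := u
  have hs : s ≤ x := hu.1
  have ht : t ≤ y := hu.2
  have e1 := linCoeff_eq_factorial α β x y
  have e2 := linCoeff_eq_factorial α β (x - s) (y - t)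
  have hx : (((x - s).factorial * x.descFactorial s : ℕ) : ℝ) = x.factorial := by
    rw [Nat.factorial_mul_descFactorial hs]
  have hy : (((y - t).factorial * y.descFactorial t : ℕ) : ℝ) = y.factorial := by
    rw [Nat.factorial_mul_descFactorial ht]
  have hn : (((x - s + (y - t)).factorial * (x + y).descFactorial (s + t) : ℕ) : ℝ) =
      (x + y).factorial := by
    rw [← Nat.factorial_mul_descFactorial (by omega : s + t ≤ x + y),
      show x + y - (s + t) = x - s + (y - t) by omega]
  push_cast at hx hy hn
  have hx0 : ((x - s).factorial : ℝ) ≠ 0 := by positivity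
  have hy0 : ((y - t).factorial : ℝ) ≠ 0 := by positivity
  rw [← hx, ← hy, ← hn] at e1
  have pa : α ^ x = α ^ (x - s) * α ^ s := by rw [← pow_add, Nat.sub_add_cancel hs]
  have pb : β ^ y = β ^ (y - t) * β ^ t := by rw [← pow_add, Nat.sub_add_cancel ht]
  rw [pa, pb] at e1
  simp only [Prod.mk_sub_mk]
  apply mul_right_cancel₀ (mul_ne_zero hx0 hy0)
  linear_combination ((α ^ s * β ^ t) * (x + y).descFactorial (s + t)) * e2 - e1

theorem tendsto_descFactorial_mul (x s : ℕ) :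
    Tendsto (fun k : ℕ => ((k * x).descFactorial s : ℝ) / (k : ℝ) ^ s) atTop
      (𝓝 ((x : ℝ) ^ s)) := by
  induction s with
  | zero => simp
  | succ s ih =>
    have h : Tendsto (fun k : ℕ => ((k * x - s : ℕ) : ℝ) / k) atTop (𝓝 (x : ℝ)) := by
      rcases Nat.eq_zero_or_pos x with rfl | hx
      · simp
      · have h1 : Tendsto (fun k : ℕ => (x : ℝ) - s / (k : ℝ)) atTop (𝓝 (x - 0)) :=
          tendsto_const_nhds.sub (tendsto_const_div_atTop_nhds_zero_nat _)
        rw [sub_zero] at h1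
        refine h1.congr' ?_
        filter_upwards [eventually_ge_atTop s, eventually_gt_atTop 0] with k hk hk0
        rw [Nat.cast_sub (hk.trans (Nat.le_mul_of_pos_right _ hx))]
        have : (k : ℝ) ≠ 0 := by positivity
        push_cast
        field_simp
    have h2 := h.mul ih
    rw [pow_succ']
    refine h2.congr fun k => ?_
    rw [Nat.descFactorial_succ, pow_succ', Nat.cast_mul]
    ring

/-- The maximum point of `z ^ p * w ^ q` on the segment `α z + β w = 1` of the quadrant. -/
def linCrit (α β : ℝ) (p q : ℕ) : ℝ × ℝ := (p / (α * (p + q)), q / (β * (p + q)))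

theorem linCrit_fst_pos {α : ℝ} (β : ℝ) {p : ℕ} (q : ℕ) (hα : 0 < α) (hp : 0 < p) :
    0 < (linCrit α β p q).1 := by unfold linCrit; positivity

theorem linCrit_snd_pos (α : ℝ) {β : ℝ} (p : ℕ) {q : ℕ} (hβ : 0 < β) (hq : 0 < q) :
    0 < (linCrit α β p q).2 := by unfold linCrit; positivity

theorem linCrit_mem_line {α β : ℝ} (hα : 0 < α) (hβ : 0 < β) {p q : ℕ} (hp : 0 < p)
    (hq : 0 < q) :
    α * (linCrit α β p q).1 + β * (linCrit α β p q).2 = 1 := by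
  simp only [linCrit]
  field_simp

/-- The falling factorials in `linCoeff_sub` are asymptotic to powers of `k p`, `k q` and `k (p +
q)`. The powers of `k` cancel and the critical point remains. -/
theorem tendsto_linCoeff_ratio {α β : ℝ} (hα : 0 < α) (hβ : 0 < β) {p q : ℕ} (hp : 0 < p)
    (hq : 0 < q)
    (u : ℕ × ℕ) :
    Tendsto (fun k : ℕ => linCoeff α β ((k * p, k * q) - u) * (linCoeff α β (k * p, k * q))⁻¹)
      atTop (𝓝 (1 * bimon (linCrit α β p q) u)) := by
  have h := ((tendsto_descFactorial_mul p u.1).mul (tendsto_descFactorial_mul q u.2)).div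
    (tendsto_descFactorial_mul (p + q) (u.1 + u.2)) (by positivity)
  have h2 := h.div_const (α ^ u.1 * β ^ u.2)
  have e : (p : ℝ) ^ u.1 * (q : ℝ) ^ u.2 / ((p + q : ℕ) : ℝ) ^ (u.1 + u.2) / (α ^ u.1 * β ^ u.2) =
      1 * bimon (linCrit α β p q) u := by
    simp only [bimon, linCrit, div_pow, mul_pow, pow_add]
    push_cast
    field_simp
  rw [e] at h2
  refine h2.congr' ?_
  filter_upwards [eventually_ge_atTop (u.1 + u.2), eventually_gt_atTop 0] with k hk hk0
  have hle1 : u.1 ≤ k * p := by nlinarith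
  have hle2 : u.2 ≤ k * q := by nlinarith
  have hu : u ≤ (k * p, k * q) := ⟨hle1, hle2⟩
  have h3 := linCoeff_sub (α := α) (β := β) hu
  have hne := (linCoeff_pos hα hβ (k * p, k * q)).ne'
  have hD : ((k * p + k * q).descFactorial (u.1 + u.2) : ℝ) ≠ 0 := by
    have : 0 < (k * p + k * q).descFactorial (u.1 + u.2) := Nat.descFactorial_pos.2 (by omega)
    positivity
  have hk' : (k : ℝ) ≠ 0 := by positivity
  have hk1 : (k : ℝ) ^ (u.1 + u.2) = (k : ℝ) ^ u.1 * (k : ℝ) ^ u.2 := pow_add _ _ _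
  simp only [Pi.div_apply]
  rw [mul_add k p q, hk1]
  have ha' : α ^ u.1 ≠ 0 := by positivity
  have hb' : β ^ u.2 ≠ 0 := by positivity
  field_simp
  linear_combination -h3

/-- The monomial at the critical point cancels the exponential parts of Stirling's formula for the
three factorials exactly. Only the square roots survive: one in the numerator against two in the
denominator, hence order `1 / √k`. -/
theorem tendsto_linCoeff_stirling {α β : ℝ} (hα : 0 < α) (hβ : 0 < β) {p q : ℕ} (hp : 0 < p)
    (hq : 0 < q) :
    Tendsto (fun k : ℕ => linCoeff α β (k * p, k * q) * bimon (linCrit α β p q) (k * p, k * q) *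
      √(k : ℝ)) atTop (𝓝 (√((p + q : ℕ) : ℝ) / (√2 * √(p : ℝ) * √(q : ℝ)) / √Real.pi)) := by
  have hS : ∀ j : ℕ, 0 < j →
      Tendsto (fun k : ℕ => Stirling.stirlingSeq (k * j)) atTop (𝓝 √Real.pi) := fun j hj =>
    Stirling.tendsto_stirlingSeq_sqrt_pi.comp (tendsto_id.atTop_mul_const' hj)
  have hpi : √Real.pi ≠ 0 := (Real.sqrt_pos.2 Real.pi_pos).ne'
  have h := (((hS (p + q) (by omega)).div ((hS p hp).mul (hS q hq))
    (mul_ne_zero hpi hpi))).const_mul (√((p + q : ℕ) : ℝ) / (√2 * √(p : ℝ) * √(q : ℝ)))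
  have e : √((p + q : ℕ) : ℝ) / (√2 * √(p : ℝ) * √(q : ℝ)) * (√Real.pi / (√Real.pi * √Real.pi)) =
      √((p + q : ℕ) : ℝ) / (√2 * √(p : ℝ) * √(q : ℝ)) / √Real.pi := by field_simp
  rw [e] at h
  refine h.congr' ?_
  filter_upwards [eventually_gt_atTop 0] with k hk
  have hfac : ∀ j : ℕ, 0 < j → ((k * j).factorial : ℝ) =
      Stirling.stirlingSeq (k * j) * (√2 * √(k : ℝ) * √(j : ℝ) *
        ((k : ℝ) * j / Real.exp 1) ^ (k * j)) := by
    intro j hj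
    have h1 : √(2 * (k * j : ℕ) : ℝ) = √2 * √(k : ℝ) * √(j : ℝ) := by
      rw [Nat.cast_mul, Real.sqrt_mul (by norm_num), Real.sqrt_mul (by positivity), mul_assoc]
    rw [Stirling.stirlingSeq, h1]
    push_cast
    have : (0 : ℝ) < k := by positivity
    have : (0 : ℝ) < j := by positivity
    have : (0 : ℝ) < √k := Real.sqrt_pos.2 (by positivity)
    have : (0 : ℝ) < √j := Real.sqrt_pos.2 (by positivity)
    field_simp
  have h1 := linCoeff_eq_factorial α β (k * p) (k * q)
  rw [← mul_add, hfac p hp, hfac q hq, hfac (p + q) (by omega)] at h1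
  have hSpos : ∀ j : ℕ, 0 < j → 0 < Stirling.stirlingSeq (k * j) := fun j hj => by
    obtain ⟨n, hn⟩ := Nat.exists_eq_succ_of_ne_zero (Nat.mul_pos hk hj).ne'
    rw [hn]; exact Stirling.stirlingSeq'_pos n
  have s1 := hSpos p hp
  have s2 := hSpos q hq
  have kpos : (0 : ℝ) < k := by positivity
  have sk : (0 : ℝ) < √(k : ℝ) := Real.sqrt_pos.2 kpos
  have sp : (0 : ℝ) < √(p : ℝ) := Real.sqrt_pos.2 (by positivity)
  have sq : (0 : ℝ) < √(q : ℝ) := Real.sqrt_pos.2 (by positivity)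
  have s2' : (0 : ℝ) < √2 := Real.sqrt_pos.2 (by norm_num)
  simp only [Pi.div_apply]
  have hX : ∀ j n : ℕ, ((k : ℝ) * j / Real.exp 1) ^ n = (k / Real.exp 1) ^ n * (j : ℝ) ^ n := by
    intro j n
    rw [← mul_pow]
    ring
  have hXpos : ∀ n : ℕ, (0 : ℝ) < (k / Real.exp 1) ^ n := fun n => by positivity
  rw [hX, hX, hX, mul_add k p q, pow_add, pow_add] at h1
  have x1 := hXpos (k * p)
  have x2 := hXpos (k * q)
  set X := ((k : ℝ) / Real.exp 1) ^ (k * p)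
  set Y := ((k : ℝ) / Real.exp 1) ^ (k * q)
  have pn : (0 : ℝ) < ((p + q : ℕ) : ℝ) := by positivity
  have hb : bimon (linCrit α β p q) (k * p, k * q) = (p : ℝ) ^ (k * p) * (q : ℝ) ^ (k * q) /
      (α ^ (k * p) * β ^ (k * q) * (((p + q : ℕ) : ℝ) ^ (k * p) * ((p + q : ℕ) : ℝ) ^ (k * q))) := by
    simp only [bimon, linCrit, div_pow, mul_pow]
    push_cast
    field_simp
  rw [hb, mul_add k p q]
  set n : ℝ := ((p + q : ℕ) : ℝ)
  rw [div_mul_div_comm, mul_div_assoc', div_mul_eq_mul_div,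
    div_eq_div_iff (by positivity) (by positivity)]
  apply mul_left_cancel₀ (mul_pos (mul_pos s2' sk) (mul_pos x1 x2)).ne'
  linear_combination -h1


/-- For short shifts, with `N = u.1 + u.2` and `n = k (p + q)`, `hN` says `n - N ≥ n / (1 + δ)`. The
falling factorial in the denominator is therefore at least `(n / (1 + δ)) ^ N`, while those in the
numerator are at most powers. -/
theorem linCoeff_ratio_bound_small {α β : ℝ} (hα : 0 < α) (hβ : 0 < β) {p q : ℕ} (hp : 0 < p)
    (hq : 0 < q) {δ : ℝ} (hδ : 0 < δ) {k : ℕ} (hk : 0 < k) {u : ℕ × ℕ} (hu : u ≤ (k * p, k * q))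
    (hN : ((u.1 + u.2 : ℕ) : ℝ) * (1 + δ) ≤ δ * (k * (p + q))) :
    linCoeff α β ((k * p, k * q) - u) * (linCoeff α β (k * p, k * q))⁻¹ ≤
      (1 + δ) ^ (u.1 + u.2) * bimon (linCrit α β p q) u := by
  have h3 := linCoeff_sub (α := α) (β := β) hu
  have hpos := linCoeff_pos hα hβ (k * p, k * q)
  have hle1 : u.1 ≤ k * p := hu.1
  have hle2 : u.2 ≤ k * q := hu.2
  have hDpos : (0 : ℝ) < ((k * p + k * q).descFactorial (u.1 + u.2) : ℝ) := by
    have : 0 < (k * p + k * q).descFactorial (u.1 + u.2) := Nat.descFactorial_pos.2 (by omega)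
    positivity
  have hx : ((k * p).descFactorial u.1 : ℝ) ≤ ((k : ℝ) * p) ^ u.1 := by
    exact_mod_cast Nat.descFactorial_le_pow (k * p) u.1
  have hy : ((k * q).descFactorial u.2 : ℝ) ≤ ((k : ℝ) * q) ^ u.2 := by
    exact_mod_cast Nat.descFactorial_le_pow (k * q) u.2
  have hD : ((k : ℝ) * (p + q)) ^ (u.1 + u.2) ≤
      (1 + δ) ^ (u.1 + u.2) * ((k * p + k * q).descFactorial (u.1 + u.2) : ℝ) := by
    have h1 : (((k * p + k * q + 1 - (u.1 + u.2) : ℕ) : ℝ)) ^ (u.1 + u.2) ≤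
        ((k * p + k * q).descFactorial (u.1 + u.2) : ℝ) := by
      exact_mod_cast Nat.pow_sub_le_descFactorial (k * p + k * q) (u.1 + u.2)
    refine le_trans ?_ (mul_le_mul_of_nonneg_left h1 (by positivity))
    rw [← mul_pow]
    refine pow_le_pow_left₀ (by positivity) ?_ _
    rw [Nat.cast_sub (by omega)]
    push_cast at hN ⊢
    nlinarith
  have ha' : 0 < α ^ u.1 := by positivity
  have hb' : 0 < β ^ u.2 := by positivity
  have hn : (0 : ℝ) < (k : ℝ) * (p + q) := by positivity
  have hb : bimon (linCrit α β p q) u = ((k : ℝ) * p) ^ u.1 * ((k : ℝ) * q) ^ u.2 /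
      (α ^ u.1 * β ^ u.2 * ((k : ℝ) * (p + q)) ^ (u.1 + u.2)) := by
    have : (k : ℝ) ≠ 0 := by positivity
    simp only [bimon, linCrit, div_pow, mul_pow, pow_add]
    field_simp
  have hratio : linCoeff α β ((k * p, k * q) - u) * (linCoeff α β (k * p, k * q))⁻¹ =
      ((k * p).descFactorial u.1 * (k * q).descFactorial u.2 : ℝ) /
        (α ^ u.1 * β ^ u.2 * (k * p + k * q).descFactorial (u.1 + u.2)) := by
    rw [← div_eq_mul_inv, div_eq_div_iff hpos.ne' (by positivity), h3]
    ring
  rw [hratio, hb, mul_div_assoc', div_le_div_iff₀ (by positivity) (by positivity)]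
  calc ((k * p).descFactorial u.1 * (k * q).descFactorial u.2 : ℝ) *
        (α ^ u.1 * β ^ u.2 * ((k : ℝ) * (p + q)) ^ (u.1 + u.2))
      ≤ (((k : ℝ) * p) ^ u.1 * ((k : ℝ) * q) ^ u.2) * (α ^ u.1 * β ^ u.2 *
        ((1 + δ) ^ (u.1 + u.2) * ((k * p + k * q).descFactorial (u.1 + u.2) : ℝ))) := by
        gcongr
    _ = _ := by ring

/-- Short shifts are covered by `linCoeff_ratio_bound_small`. For long ones the numerator is at most
one binomial term and the denominator is bounded below by Stirling, at the cost of a factor `k`;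
since `u.1 + u.2` then exceeds a fixed multiple of `k`, `(1 + δ) ^ (u.1 + u.2)` absorbs it. -/
theorem exists_linCoeff_ratio_bound {α β : ℝ} (hα : 0 < α) (hβ : 0 < β) {p q : ℕ} (hp : 0 < p)
    (hq : 0 < q) {δ : ℝ} (hδ : 0 < δ) :
    ∃ C : ℝ, 0 ≤ C ∧ ∀ᶠ k : ℕ in atTop, ∀ u : ℕ × ℕ, u ≤ (k * p, k * q) →
      |linCoeff α β ((k * p, k * q) - u) * (linCoeff α β (k * p, k * q))⁻¹| ≤
        C * bimon ((1 + δ) * (linCrit α β p q).1, (1 + δ) * (linCrit α β p q).2) u := by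
  set c := √((p + q : ℕ) : ℝ) / (√2 * √(p : ℝ) * √(q : ℝ)) / √Real.pi with hc
  have hcpos : 0 < c := by positivity
  have hlim := tendsto_linCoeff_stirling hα hβ hp hq
  rw [← hc] at hlim
  have hev := hlim.eventually (lt_mem_nhds (half_lt_self hcpos))
  set P := linCrit α β p q with hP
  have P1 : 0 < P.1 := linCrit_fst_pos β q hα hp
  have P2 : 0 < P.2 := linCrit_snd_pos α p hβ hq
  -- `2 / c` comes from the lower bound `c / 2` in Stirling's limit, the other factor from
  -- Bernoulli's inequality in `h3`.
  set K := 2 / c * ((1 + δ) / (δ ^ 2 * (p + q))) with hK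
  have hKpos : 0 < K := by positivity
  refine ⟨1 + K, by positivity, ?_⟩
  filter_upwards [hev, eventually_gt_atTop 0] with k hk hk0 u hu
  have hpos := linCoeff_pos hα hβ (k * p, k * q)
  have hpos' := linCoeff_pos hα hβ ((k * p, k * q) - u)
  have hPu := bimon_pos P1 P2 u
  have hPn := bimon_pos P1 P2 (k * p, k * q)
  have hscale : bimon ((1 + δ) * P.1, (1 + δ) * P.2) u = (1 + δ) ^ (u.1 + u.2) * bimon P u := by
    simp only [bimon, mul_pow, pow_add]; ring
  rw [abs_of_pos (by positivity), hscale]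
  have hDu : 0 < (1 + δ) ^ (u.1 + u.2) * bimon P u := by positivity
  rcases le_or_gt (((u.1 + u.2 : ℕ) : ℝ) * (1 + δ)) (δ * (k * (p + q))) with hN | hN
  · refine (linCoeff_ratio_bound_small hα hβ hp hq hδ hk0 hu hN).trans ?_
    rw [one_add_mul]
    exact le_add_of_nonneg_right (mul_pos hKpos hDu).le
  · have h1 := linCoeff_mul_bimon_le_one hα.le hβ.le P1.le P2.le (linCrit_mem_line hα hβ hp hq)
      ((k * p, k * q) - u)
    have hsplit : bimon P (k * p, k * q) = bimon P ((k * p, k * q) - u) * bimon P u := by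
      rw [← bimon_add, tsub_add_cancel_of_le hu]
    have kpos : (0 : ℝ) < k := by positivity
    have hkone : (1 : ℝ) ≤ k := by exact_mod_cast hk0
    have hsqrt : √(k : ℝ) ≤ k := by
      rw [Real.sqrt_le_left kpos.le]; nlinarith
    have h2 : (linCoeff α β (k * p, k * q))⁻¹ ≤ 2 / c * (k * bimon P (k * p, k * q)) := by
      rw [inv_le_iff_one_le_mul₀ hpos]
      have : c / 2 ≤ linCoeff α β (k * p, k * q) * bimon P (k * p, k * q) * k :=
        hk.le.trans (mul_le_mul_of_nonneg_left hsqrt (by positivity))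
      calc (1 : ℝ) = 2 / c * (c / 2) := by field_simp
        _ ≤ 2 / c * (linCoeff α β (k * p, k * q) * bimon P (k * p, k * q) * k) := by gcongr
        _ = _ := by ring
    have h3 : (k : ℝ) ≤ (1 + δ) / (δ ^ 2 * (p + q)) * (1 + δ) ^ (u.1 + u.2) := by
      have hB := one_add_mul_le_pow (by linarith : (-2 : ℝ) ≤ δ) (u.1 + u.2)
      have pq : (0 : ℝ) < p + q := by positivity
      rw [div_mul_eq_mul_div, le_div_iff₀ (by positivity)]
      have h4 : ((u.1 + u.2 : ℕ) : ℝ) * δ ≤ (1 + δ) ^ (u.1 + u.2) := by linarith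
      calc (k : ℝ) * (δ ^ 2 * (p + q)) = δ * (δ * (k * (p + q))) := by ring
        _ ≤ δ * (((u.1 + u.2 : ℕ) : ℝ) * (1 + δ)) := by gcongr
        _ = (1 + δ) * (((u.1 + u.2 : ℕ) : ℝ) * δ) := by ring
        _ ≤ _ := by gcongr
    calc linCoeff α β ((k * p, k * q) - u) * (linCoeff α β (k * p, k * q))⁻¹
        ≤ linCoeff α β ((k * p, k * q) - u) * (2 / c * (k * bimon P (k * p, k * q))) := by gcongr
      _ = (linCoeff α β ((k * p, k * q) - u) * bimon P ((k * p, k * q) - u)) *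
          (2 / c * (k * bimon P u)) := by rw [hsplit]; ring
      _ ≤ 1 * (2 / c * (k * bimon P u)) := by gcongr
      _ ≤ 1 * (2 / c * ((1 + δ) / (δ ^ 2 * (p + q)) * (1 + δ) ^ (u.1 + u.2) * bimon P u)) := by
          gcongr
      _ = K * ((1 + δ) ^ (u.1 + u.2) * bimon P u) := by rw [hK]; ring
      _ ≤ _ := by
          rw [one_add_mul]
          exact le_add_of_nonneg_left hDu.le

/-- Asymptotics along a diagonal of a Cauchy product with the coefficients of `1 / (1 - αz - βw)`
when the other factor converges beyond the critical point. -/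
theorem tendsto_conv_linCoeff {α β : ℝ} (hα : 0 < α) (hβ : 0 < β) {p q : ℕ} (hp : 0 < p)
    (hq : 0 < q) {e : ℕ × ℕ → ℝ} (he : ∀ n, 0 ≤ e n) {δ : ℝ} (hδ : 0 < δ)
    (hsum : Summable fun n =>
      e n * bimon ((1 + δ) * (linCrit α β p q).1, (1 + δ) * (linCrit α β p q).2) n) :
    Tendsto (fun k : ℕ => conv e (linCoeff α β) (k * p, k * q) *
      bimon (linCrit α β p q) (k * p, k * q) * √(k : ℝ)) atTop
      (𝓝 ((∑' u, e u * bimon (linCrit α β p q) u) *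
        (√((p + q : ℕ) : ℝ) / (√2 * √(p : ℝ) * √(q : ℝ)) / √Real.pi))) := by
  obtain ⟨C, hC, hbd⟩ := exists_linCoeff_ratio_bound hα hβ hp hq hδ
  have P1 : 0 < (linCrit α β p q).1 := linCrit_fst_pos β q hα hp
  have P2 : 0 < (linCrit α β p q).2 := linCrit_snd_pos α p hβ hq
  have h1 := tendsto_conv_diagonal he hC (mul_pos (by linarith) P1) (mul_pos (by linarith) P2)
    hsum (tendsto_linCoeff_ratio hα hβ hp hq) hbd hp hq
  have h2 := h1.mul (tendsto_linCoeff_stirling hα hβ hp hq)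
  rw [one_mul] at h2
  refine h2.congr fun k => ?_
  have := (linCoeff_pos hα hβ (k * p, k * q)).ne'
  field_simp

/-! ### Tails of the negative binomial law. -/

theorem eventually_lt_of_hasDerivAt_pos {f : ℝ → ℝ} {f' x : ℝ} (h : HasDerivAt f f' x)
    (hf : 0 < f') : ∀ᶠ y in 𝓝[>] x, f x < f y := by
  have h1 := (hasDerivAt_iff_tendsto_slope.1 h).eventually (lt_mem_nhds hf)
  have h2 := h1.filter_mono (nhdsWithin_mono x (fun y (hy : x < y) => ne_of_gt hy))
  filter_upwards [h2, self_mem_nhdsWithin] with y hy (hxy : x < y)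
  rw [slope_def_field, div_pos_iff_of_pos_right (sub_pos.2 hxy)] at hy
  linarith

theorem eventually_lt_of_hasDerivAt_neg {f : ℝ → ℝ} {f' x : ℝ} (h : HasDerivAt f f' x)
    (hf : f' < 0) : ∀ᶠ y in 𝓝[<] x, f x < f y := by
  have h1 := (hasDerivAt_iff_tendsto_slope.1 h).eventually (gt_mem_nhds hf)
  have h2 := h1.filter_mono (nhdsWithin_mono x (fun y (hy : y < x) => ne_of_lt hy))
  filter_upwards [h2, self_mem_nhdsWithin] with y hy (hxy : y < x)
  rw [slope_def_field, div_neg_iff] at hy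
  rcases hy with h | h <;> linarith

/-- The cumulative distribution function at `x` of the negative binomial law with `y + 1`
successes of probability `1 - u`. -/
def negBinCdf (u : ℝ) (x y : ℕ) : ℝ :=
  (1 - u) ^ (y + 1) * ∑ s ∈ Finset.range (x + 1), ((s + y).choose y : ℝ) * u ^ s

theorem hasSum_negBin {u : ℝ} (h0 : 0 ≤ u) (h1 : u < 1) (y : ℕ) :
    HasSum (fun s : ℕ => ((s + y).choose y : ℝ) * u ^ s) (1 / (1 - u) ^ (y + 1)) :=
  hasSum_choose_mul_geometric_of_norm_lt_one y (by rwa [Real.norm_eq_abs, abs_of_nonneg h0])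

theorem negBinCdf_nonneg {u : ℝ} (h0 : 0 ≤ u) (h1 : u < 1) (x y : ℕ) : 0 ≤ negBinCdf u x y :=
  mul_nonneg (pow_nonneg (by linarith) _) (Finset.sum_nonneg fun _ _ => by positivity)

/-- Chernoff's bound for the lower tail. -/
theorem negBinCdf_mul_le {u c : ℝ} (h0 : 0 ≤ u) (h1 : u < 1) (hc0 : 0 < c) (hc1 : c ≤ 1)
    (x y : ℕ) : negBinCdf u x y * c ^ x * (1 - c * u) ^ (y + 1) ≤ (1 - u) ^ (y + 1) := by
  have hcu : c * u < 1 := lt_of_le_of_lt (mul_le_of_le_one_left h0 hc1) h1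
  have hpos : 0 < (1 - c * u) ^ (y + 1) := pow_pos (by linarith) _
  have hs := sum_le_hasSum (Finset.range (x + 1)) (fun s _ => by positivity)
    (hasSum_negBin (mul_nonneg hc0.le h0) hcu y)
  -- Exponential tilting: `c ^ x ≤ c ^ s` for `s ≤ x`, because `c ≤ 1`.
  have h2 : (∑ s ∈ Finset.range (x + 1), ((s + y).choose y : ℝ) * u ^ s) * c ^ x ≤
      ∑ s ∈ Finset.range (x + 1), ((s + y).choose y : ℝ) * (c * u) ^ s := by
    rw [Finset.sum_mul]
    refine Finset.sum_le_sum fun s hs => ?_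
    have : c ^ x ≤ c ^ s := pow_le_pow_of_le_one hc0.le hc1 (by simpa [Nat.lt_succ_iff] using hs)
    rw [mul_pow]
    calc ((s + y).choose y : ℝ) * u ^ s * c ^ x ≤ ((s + y).choose y : ℝ) * u ^ s * c ^ s := by
          gcongr
      _ = _ := by ring
  have h3 : 0 ≤ (1 - u) ^ (y + 1) := pow_nonneg (by linarith) _
  rw [negBinCdf]
  calc (1 - u) ^ (y + 1) * (∑ s ∈ Finset.range (x + 1), ((s + y).choose y : ℝ) * u ^ s) * c ^ x *
        (1 - c * u) ^ (y + 1)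
      = (1 - u) ^ (y + 1) * (((∑ s ∈ Finset.range (x + 1), ((s + y).choose y : ℝ) * u ^ s) *
        c ^ x) * (1 - c * u) ^ (y + 1)) := by ring
    _ ≤ (1 - u) ^ (y + 1) * (1 / (1 - c * u) ^ (y + 1) * (1 - c * u) ^ (y + 1)) := by
        gcongr
        exact h2.trans hs
    _ = (1 - u) ^ (y + 1) := by rw [one_div, inv_mul_cancel₀ hpos.ne', mul_one]

/-- Chernoff's bound for the upper tail. -/
theorem one_sub_negBinCdf_mul_le {u c : ℝ} (h0 : 0 ≤ u) (h1 : u < 1) (hc1 : 1 ≤ c)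
    (hcu : c * u < 1) (x y : ℕ) :
    (1 - negBinCdf u x y) * c ^ x * (1 - c * u) ^ (y + 1) ≤ (1 - u) ^ (y + 1) := by
  have hc0 : 0 < c := by linarith
  have hpos : 0 < (1 - c * u) ^ (y + 1) := pow_pos (by linarith) _
  have hpos' : 0 < (1 - u) ^ (y + 1) := pow_pos (by linarith) _
  -- The partial sum is written as a series so that subtracting it leaves the tail `s > x` termwise.
  have hfin : HasSum (fun s : ℕ => if s ∈ Finset.range (x + 1) then
      ((s + y).choose y : ℝ) * u ^ s else 0)
      (∑ s ∈ Finset.range (x + 1), ((s + y).choose y : ℝ) * u ^ s) := by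
    have := hasSum_sum_of_ne_finset_zero (L := SummationFilter.unconditional ℕ)
      (s := Finset.range (x + 1)) (f := fun s : ℕ => if s ∈ Finset.range (x + 1) then
      ((s + y).choose y : ℝ) * u ^ s else 0) (fun s hs => if_neg hs)
    exact hasSum_of_eq this (fun _ => rfl) (Finset.sum_congr rfl fun s hs => (if_pos hs).symm)
  have htail := ((hasSum_negBin h0 h1 y).sub hfin).mul_right (c ^ x)
  have hle := hasSum_le (fun s => ?_) htail (hasSum_negBin (mul_nonneg hc0.le h0) hcu y)
  · have e : (1 - negBinCdf u x y) = (1 - u) ^ (y + 1) * (1 / (1 - u) ^ (y + 1) -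
        ∑ s ∈ Finset.range (x + 1), ((s + y).choose y : ℝ) * u ^ s) := by
      rw [negBinCdf]; field_simp
    rw [e, mul_assoc, mul_assoc, ← mul_assoc _ (c ^ x)]
    calc _ ≤ (1 - u) ^ (y + 1) * (1 / (1 - c * u) ^ (y + 1) * (1 - c * u) ^ (y + 1)) := by
          gcongr
      _ = (1 - u) ^ (y + 1) := by rw [one_div, inv_mul_cancel₀ hpos.ne', mul_one]
  · by_cases hs : s ∈ Finset.range (x + 1)
    · simp only [if_pos hs, sub_self, zero_mul]; positivity
    · simp only [if_neg hs, sub_zero]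
      have : c ^ x ≤ c ^ s := pow_le_pow_right₀ hc1 (by
        simp only [Finset.mem_range] at hs; omega)
      rw [mul_pow]
      calc ((s + y).choose y : ℝ) * u ^ s * c ^ x ≤ ((s + y).choose y : ℝ) * u ^ s * c ^ s := by
            gcongr
        _ = _ := by ring

theorem negBinCdf_le_one {u : ℝ} (h0 : 0 ≤ u) (h1 : u < 1) (x y : ℕ) : negBinCdf u x y ≤ 1 := by
  have h := negBinCdf_mul_le h0 h1 one_pos le_rfl x y
  rw [one_pow, mul_one, one_mul] at h
  have hpos : 0 < (1 - u) ^ (y + 1) := pow_pos (by linarith) _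
  exact le_of_mul_le_mul_right (by linarith) hpos

/-- On the diagonal the bound is a constant depending on `s`, `t` times the `k`-th power of `D ^ q /
(A ^ p * B ^ q) < 1`. -/
theorem tendsto_zero_of_geometric_bound {τ : ℕ → ℕ → ℝ} {A B D : ℝ} {p q : ℕ} (hp : 0 < p)
    (hq : 0 < q) (hA : 0 < A) (hB : 0 < B) (hD : 0 < D) (h0 : ∀ x y, 0 ≤ τ x y)
    (h : ∀ x y, τ x y * A ^ x * B ^ (y + 1) ≤ D ^ (y + 1)) (hlt : D ^ q < A ^ p * B ^ q)
    (s t : ℕ) : Tendsto (fun k : ℕ => τ (k * p - s) (k * q - t)) atTop (𝓝 0) := by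
  have hg := (tendsto_pow_atTop_nhds_zero_of_lt_one (r := D ^ q / (A ^ p * B ^ q))
    (by positivity) (by rwa [div_lt_one (by positivity)])).mul_const
      (A ^ s * B ^ t * D / (B * D ^ t))
  rw [zero_mul] at hg
  refine squeeze_zero' (Eventually.of_forall fun k => h0 _ _) ?_ hg
  filter_upwards [eventually_ge_atTop (s + t)] with k hk
  have hs : s ≤ k * p := by nlinarith
  have ht : t ≤ k * q := by nlinarith
  have hb := h (k * p - s) (k * q - t)
  rw [pow_succ, pow_succ, pow_sub₀ A hA.ne' hs, pow_sub₀ B hB.ne' ht, pow_sub₀ D hD.ne' ht] at hb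
  have eA : (A ^ p) ^ k = A ^ (k * p) := by rw [← pow_mul, mul_comm]
  have eB : (B ^ q) ^ k = B ^ (k * q) := by rw [← pow_mul, mul_comm]
  have eD : (D ^ q) ^ k = D ^ (k * q) := by rw [← pow_mul, mul_comm]
  rw [div_pow, mul_pow, eA, eB, eD]
  rw [mul_assoc, ← le_div_iff₀ (by positivity)] at hb
  refine hb.trans (le_of_eq ?_)
  field_simp

/-- The function takes the value `(1 - u) ^ q` at `c = 1`. The sign of its derivative tells on which
side of `1` a Chernoff parameter `c` with `(1 - u) ^ q < c ^ p * (1 - c * u) ^ q` exists. -/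
theorem hasDerivAt_pow_mul_pow (u : ℝ) (p q : ℕ) (hq : 0 < q) :
    HasDerivAt (fun c : ℝ => c ^ p * (1 - c * u) ^ q)
      ((1 - u) ^ (q - 1) * (p * (1 - u) - q * u)) 1 := by
  have h1 : HasDerivAt (fun c : ℝ => 1 - c * u) (-(1 * u)) 1 :=
    ((hasDerivAt_id (1 : ℝ)).mul_const u).const_sub 1
  have h2 := (hasDerivAt_pow p (1 : ℝ)).mul (h1.pow q)
  refine h2.congr_deriv ?_
  obtain ⟨n, rfl⟩ := Nat.exists_eq_succ_of_ne_zero hq.ne'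
  simp only [Nat.succ_eq_add_one, Nat.add_sub_cancel, one_pow, one_mul, mul_one, Pi.pow_apply,
    pow_succ]
  ring

/-- Law of large numbers: the mean is about `k q u / (1 - u)`, which exceeds the threshold `k p` by
a fixed proportion. The shifts `s`, `t` do not matter. -/
theorem tendsto_negBinCdf_zero {u : ℝ} (h0 : 0 < u) (h1 : u < 1) {p q : ℕ} (hp : 0 < p)
    (hq : 0 < q) (h : p * (1 - u) < q * u) (s t : ℕ) :
    Tendsto (fun k : ℕ => negBinCdf u (k * p - s) (k * q - t)) atTop (𝓝 0) := by
  have hd := eventually_lt_of_hasDerivAt_neg (hasDerivAt_pow_mul_pow u p q hq)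
    (mul_neg_of_pos_of_neg (pow_pos (by linarith) _) (by linarith))
  have hpos : ∀ᶠ c : ℝ in 𝓝[<] 1, 0 < c := nhdsWithin_le_nhds (lt_mem_nhds one_pos)
  obtain ⟨c, ⟨hc, hc0⟩, hc1 : c < 1⟩ := ((hd.and hpos).and self_mem_nhdsWithin).exists
  simp only [one_pow, one_mul] at hc
  have hcu : c * u < 1 := by nlinarith
  exact tendsto_zero_of_geometric_bound hp hq hc0 (by linarith : 0 < 1 - c * u)
    (by linarith : 0 < 1 - u) (negBinCdf_nonneg h0.le h1)
    (negBinCdf_mul_le h0.le h1 hc0 hc1.le) hc s t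

theorem tendsto_negBinCdf_one {u : ℝ} (h0 : 0 < u) (h1 : u < 1) {p q : ℕ} (hp : 0 < p)
    (hq : 0 < q) (h : q * u < p * (1 - u)) (s t : ℕ) :
    Tendsto (fun k : ℕ => negBinCdf u (k * p - s) (k * q - t)) atTop (𝓝 1) := by
  have hd := eventually_lt_of_hasDerivAt_pos (hasDerivAt_pow_mul_pow u p q hq)
    (mul_pos (pow_pos (by linarith) _) (by linarith))
  have hpos : ∀ᶠ c : ℝ in 𝓝[>] 1, c * u < 1 :=
    nhdsWithin_le_nhds ((continuous_mul_const u).continuousAt.eventually_lt continuousAt_const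
      (by simpa using h1))
  obtain ⟨c, ⟨hc, hcu⟩, hc1 : 1 < c⟩ := ((hd.and hpos).and self_mem_nhdsWithin).exists
  simp only [one_pow, one_mul] at hc
  have := tendsto_zero_of_geometric_bound (τ := fun x y => 1 - negBinCdf u x y) hp hq
    (by linarith : 0 < c) (by linarith : 0 < 1 - c * u)
    (by linarith : 0 < 1 - u) (fun x y => sub_nonneg.2 (negBinCdf_le_one h0.le h1 x y))
    (one_sub_negBinCdf_mul_le h0.le h1 hc1.le hcu) hc s t
  simpa using this.const_sub 1

/-! ### The product of two linear factors -/

theorem factor_ne_zero_of_small {α β : ℝ} (hα : 0 ≤ α) (hβ : 0 ≤ β) {P : ℂ × ℂ}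
    (h : α * ‖P.1‖ + β * ‖P.2‖ < 1) : factor (α : ℂ) (β : ℂ) P.1 P.2 ≠ 0 := by
  intro h0
  have h1 : (α : ℂ) * P.1 + β * P.2 = 1 := by rw [factor] at h0; linear_combination -h0
  have h2 := norm_add_le ((α : ℂ) * P.1) (β * P.2)
  rw [h1] at h2
  simp [abs_of_nonneg hα, abs_of_nonneg hβ] at h2
  linarith

/-- Coefficient comparison in `β' Q - β Q' = (β' - β) - (α β' - α' β) z` divided by `Q Q'`. The `if`
is multiplication by `z`. -/
theorem conv_linCoeff_recursion {α β α' β' : ℝ} (hα : 0 ≤ α) (hβ : 0 ≤ β) (hα' : 0 ≤ α')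
    (hβ' : 0 ≤ β') (n : ℕ × ℕ) :
    (β' - β) * conv (linCoeff α β) (linCoeff α' β') n - (α * β' - α' * β) *
      (if n.1 = 0 then 0 else conv (linCoeff α β) (linCoeff α' β') (n.1 - 1, n.2)) =
    β' * linCoeff α' β' n - β * linCoeff α β n := by
  set G := conv (linCoeff α β) (linCoeff α' β') with hG
  let c : ℕ × ℕ → ℝ := fun n => (β' - β) * G n -
    (α * β' - α' * β) * (if n.1 = 0 then 0 else G (n.1 - 1, n.2))
  let d : ℕ × ℕ → ℝ := fun n => β' * linCoeff α' β' n - β * linCoeff α β n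
  have hsmall := eventually_small ![α, α'] ![β, β']
  have key : (fun n => (c n : ℂ)) = fun n => (d n : ℂ) := by
    refine dcoeff_unique (F := fun P => β' * (1 / factor (α' : ℂ) (β' : ℂ) P.1 P.2) -
      β * (1 / factor (α : ℂ) (β : ℂ) P.1 P.2)) ?_ ?_
    · filter_upwards [hsmall] with P hP
      have s1 : α * ‖P.1‖ + β * ‖P.2‖ < 1 := hP 0
      have s2 : α' * ‖P.1‖ + β' * ‖P.2‖ < 1 := hP 1
      have hGs : HasSum (fun n => (G n : ℂ) * bimon P n) _ :=
        hasSum_of_eq (hasSum_conv (hasSum_linCoeff hα hβ s1) (hasSum_linCoeff hα' hβ' s2))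
          (fun n => by rw [hG, ofReal_conv]) rfl
      let sh : ℕ × ℕ → ℕ × ℕ := fun n => (n.1 + 1, n.2)
      have hsh : Function.Injective sh := by
        rintro ⟨x, y⟩ ⟨x', y'⟩ h
        simpa [sh] using h
      have hshift : HasSum (fun n : ℕ × ℕ =>
          ((if n.1 = 0 then 0 else G (n.1 - 1, n.2) : ℝ) : ℂ) * bimon P n)
          (1 / factor (α : ℂ) (β : ℂ) P.1 P.2 * (1 / factor (α' : ℂ) (β' : ℂ) P.1 P.2) * P.1) := by
        rw [← hsh.hasSum_iff]
        · refine hasSum_of_eq (hGs.mul_right P.1) (fun n => ?_) rfl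
          simp only [sh, Function.comp, Nat.add_sub_cancel, bimon, Nat.succ_ne_zero, if_false,
            pow_succ]
          ring
        · rintro ⟨x, y⟩ hx
          have : x = 0 := by
            by_contra h0
            exact hx ⟨(x - 1, y), by simp only [sh, Prod.mk.injEq, and_true]; omega⟩
          simp [this]
      refine hasSum_of_eq ((hGs.mul_left ((β' : ℂ) - β)).sub
        (hshift.mul_left ((α : ℂ) * β' - α' * β))) (fun n => ?_) ?_
      · simp only [c]; push_cast; ring
      · have q1 := factor_ne_zero_of_small hα hβ s1
        have q2 := factor_ne_zero_of_small hα' hβ' s2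
        field_simp
        simp only [factor]
        ring
    · filter_upwards [hsmall] with P hP
      refine hasSum_of_eq (((hasSum_linCoeff hα' hβ' (hP 1)).mul_left (β' : ℂ)).sub
        ((hasSum_linCoeff hα hβ (hP 0)).mul_left (β : ℂ))) (fun n => ?_) rfl
      simp only [d]; push_cast; ring
  exact_mod_cast congrFun key n

/-- Since `(α β' - α' β) P.1 = β' - β`, the recursion multiplied by `P.1 ^ x * P.2 ^ (y + 1)`
telescopes in `x`. Because `1 - α P.1 = β P.2`, each increment is a difference of two negative
binomial weights. -/
theorem conv_linCoeff_eq_negBinCdf {α β α' β' : ℝ} (hα : 0 ≤ α) (hβ : 0 ≤ β) (hα' : 0 ≤ α')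
    (hβ' : 0 ≤ β') {P : ℝ × ℝ} (h : α * P.1 + β * P.2 = 1) (h' : α' * P.1 + β' * P.2 = 1)
    (x y : ℕ) :
    (β' - β) * conv (linCoeff α β) (linCoeff α' β') (x, y) * (P.1 ^ x * P.2 ^ (y + 1)) =
      negBinCdf (α' * P.1) x y - negBinCdf (α * P.1) x y := by
  have hterm : ∀ {α β : ℝ} (_ : α * P.1 + β * P.2 = 1) (x : ℕ),
      β * linCoeff α β (x, y) * (P.1 ^ x * P.2 ^ (y + 1)) =
        (1 - α * P.1) ^ (y + 1) * (((x + y).choose y : ℝ) * (α * P.1) ^ x) := by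
    intro α β h x
    rw [show 1 - α * P.1 = β * P.2 by linarith]
    simp only [linCoeff, mul_pow, pow_succ]
    ring
  induction x with
  | zero =>
    have hr := conv_linCoeff_recursion hα hβ hα' hβ' (0, y)
    simp only [if_true, mul_zero, sub_zero] at hr
    rw [hr, sub_mul, hterm h, hterm h']
    simp [negBinCdf]
  | succ x ih =>
    have hr := conv_linCoeff_recursion hα hβ hα' hβ' (x + 1, y)
    simp only [Nat.succ_ne_zero, if_false, Nat.add_sub_cancel] at hr
    have t1 := hterm h (x + 1)
    have t2 := hterm h' (x + 1)
    have hΔ : (α * β' - α' * β) * P.1 = β' - β := by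
      linear_combination β' * h - β * h'
    have n1 : ∀ u : ℝ, negBinCdf u (x + 1) y = negBinCdf u x y +
        (1 - u) ^ (y + 1) * (((x + 1 + y).choose y : ℝ) * u ^ (x + 1)) := by
      intro u
      rw [negBinCdf, Finset.sum_range_succ, mul_add, negBinCdf]
    rw [n1, n1, ← t1, ← t2]
    rw [pow_succ P.1]
    linear_combination (P.1 ^ x * P.1 * P.2 ^ (y + 1)) * hr + ih +
      conv (linCoeff α β) (linCoeff α' β') (x, y) * (P.1 ^ x * P.2 ^ (y + 1)) * hΔ

/-- Asymptotics along a diagonal of a Cauchy product with the coefficients of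
`1 / ((1 - αz - βw)(1 - α'z - β'w))`, for a direction strictly between the normals of the
two lines at their common point. -/
theorem tendsto_conv_pair {α β α' β' : ℝ} (hα : 0 < α) (hβ : 0 < β) (hα' : 0 < α')
    (hβ' : 0 < β') {P : ℝ × ℝ} (h₁ : 0 < P.1) (h₂ : 0 < P.2) (h : α * P.1 + β * P.2 = 1)
    (h' : α' * P.1 + β' * P.2 = 1) (hΔ : α * β' - α' * β ≠ 0) {p q : ℕ} (hp : 0 < p) (hq : 0 < q)
    (hlo : q * (α * P.1) < p * (β * P.2)) (hhi : p * (β' * P.2) < q * (α' * P.1))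
    {e : ℕ × ℕ → ℝ} (he : ∀ n, 0 ≤ e n) (hsum : Summable fun n => e n * bimon P n) :
    Tendsto (fun k : ℕ => conv e (conv (linCoeff α β) (linCoeff α' β')) (k * p, k * q) *
      (P.1 ^ (k * p + 1) * P.2 ^ (k * q + 1))) atTop
      (𝓝 (-1 / (α * β' - α' * β) * ∑' u, e u * bimon P u)) := by
  set G := conv (linCoeff α β) (linCoeff α' β') with hG
  have hΔ' : (α * β' - α' * β) * P.1 = β' - β := by
    linear_combination β' * h - β * h'
  set D := α * β' - α' * β with hD
  have hu0 : 0 < α * P.1 := mul_pos hα h₁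
  have hu0' : 0 < α' * P.1 := mul_pos hα' h₁
  have hb : 0 < β * P.2 := mul_pos hβ h₂
  have hb' : 0 < β' * P.2 := mul_pos hβ' h₂
  have hu1 : α * P.1 < 1 := by linarith
  have hu1' : α' * P.1 < 1 := by linarith
  have key : ∀ (k : ℕ) (u : ℕ × ℕ), u ≤ (k * p, k * q) →
      G ((k * p, k * q) - u) * (P.1 ^ (k * p + 1) * P.2 ^ (k * q + 1)) =
        (negBinCdf (α' * P.1) (k * p - u.1) (k * q - u.2) -
          negBinCdf (α * P.1) (k * p - u.1) (k * q - u.2)) / D * bimon P u := by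
    rintro k ⟨s, t⟩ hu
    have hs : s ≤ k * p := hu.1
    have ht : t ≤ k * q := hu.2
    -- Replacing `β' - β` by `D * P.1` supplies the last power of `P.1`, and dividing by `D` is
    -- legitimate.
    rw [← conv_linCoeff_eq_negBinCdf hα.le hβ.le hα'.le hβ'.le h h', ← hG, ← hΔ']
    simp only [Prod.mk_sub_mk, bimon]
    have e1 : P.1 ^ (k * p + 1) = P.1 ^ (k * p - s) * P.1 ^ s * P.1 := by
      rw [← pow_add, Nat.sub_add_cancel hs, pow_succ]
    have e2 : P.2 ^ (k * q + 1) = P.2 ^ (k * q - t + 1) * P.2 ^ t := by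
      rw [← pow_add]; congr 1; omega
    rw [e1, e2]
    field_simp
  -- The constant `1 / |D|` suffices because two numbers in `[0, 1]` differ by at most `1`; no
  -- enlarged point is needed, so `P' = P`.
  refine tendsto_conv_diagonal (C := 1 / |D|) he (by positivity) h₁ h₂ hsum (fun u => ?_) ?_ hp hq
  · have l0 := tendsto_negBinCdf_zero hu0' hu1' hp hq (by
      rwa [show 1 - α' * P.1 = β' * P.2 by linarith]) u.1 u.2
    have l1 := tendsto_negBinCdf_one hu0 hu1 hp hq (by
      rwa [show 1 - α * P.1 = β * P.2 by linarith]) u.1 u.2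
    have l2 := ((l0.sub l1).div_const D).mul_const (bimon P u)
    rw [zero_sub] at l2
    refine l2.congr' ?_
    filter_upwards [eventually_ge_atTop u.1, eventually_ge_atTop u.2] with k hk1 hk2
    exact (key k u ⟨hk1.trans (Nat.le_mul_of_pos_right _ hp),
      hk2.trans (Nat.le_mul_of_pos_right _ hq)⟩).symm
  · filter_upwards with k u hu
    rw [key k u hu, abs_mul, abs_of_pos (bimon_pos h₁ h₂ u), abs_div]
    have := bimon_pos h₁ h₂ u
    gcongr
    have a1 := negBinCdf_nonneg hu0.le hu1 (k * p - u.1) (k * q - u.2)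
    have a2 := negBinCdf_le_one hu0.le hu1 (k * p - u.1) (k * q - u.2)
    have a3 := negBinCdf_nonneg hu0'.le hu1' (k * p - u.1) (k * q - u.2)
    have a4 := negBinCdf_le_one hu0'.le hu1' (k * p - u.1) (k * q - u.2)
    rw [abs_le]
    constructor <;> linarith

/-! ### The cones: linear inequalities and first-order conditions. -/

/-- From an interior point a small step against the gradient `(x, y)` stays in `S` and strictly
decreases the form, which must still be nonnegative. -/
theorem pos_of_mem_interior_of_subset {S : Set (ℝ × ℝ)} {x y : ℝ} (hxy : ¬ (x = 0 ∧ y = 0))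
    (hS : ∀ d ∈ S, 0 ≤ x * d.1 + y * d.2) {d : ℝ × ℝ} (hd : d ∈ interior S) :
    0 < x * d.1 + y * d.2 := by
  have hc : Continuous fun t : ℝ => (d.1 - t * x, d.2 - t * y) := by fun_prop
  have h0 : Tendsto (fun t : ℝ => (d.1 - t * x, d.2 - t * y)) (𝓝[>] 0) (𝓝 d) := by
    have := hc.tendsto 0
    simp only [zero_mul, sub_zero] at this
    exact this.mono_left nhdsWithin_le_nhds
  have h1 := h0.eventually (mem_interior_iff_mem_nhds.1 hd)
  obtain ⟨t, ht, ht0 : 0 < t⟩ := (h1.and self_mem_nhdsWithin).exists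
  have h2 := hS _ ht
  have h3 : 0 < x ^ 2 + y ^ 2 := by
    by_contra h
    refine hxy ⟨?_, ?_⟩ <;> nlinarith [sq_nonneg x, sq_nonneg y]
  have h4 := mul_pos ht0 h3
  simp only at h2
  nlinarith

theorem fst_pos_of_mem_interior {S : Set (ℝ × ℝ)} (hS : ∀ d ∈ S, 0 ≤ d.1) {d : ℝ × ℝ}
    (hd : d ∈ interior S) : 0 < d.1 := by
  simpa using pos_of_mem_interior_of_subset (x := 1) (y := 0) (by simp)
    (fun d hd => by simpa using hS d hd) hd

theorem snd_pos_of_mem_interior {S : Set (ℝ × ℝ)} (hS : ∀ d ∈ S, 0 ≤ d.2) {d : ℝ × ℝ}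
    (hd : d ∈ interior S) : 0 < d.2 := by
  simpa using pos_of_mem_interior_of_subset (x := 0) (y := 1) (by simp)
    (fun d hd => by simpa using hS d hd) hd

/-- The tangent-line form of the weighted inequality of arithmetic and geometric means. -/
theorem monomial_le_of_tangent {d P Q : ℝ × ℝ} (hd₁ : 0 ≤ d.1) (hd₂ : 0 ≤ d.2) (hP₁ : 0 < P.1)
    (hP₂ : 0 < P.2) (hQ₁ : 0 ≤ Q.1) (hQ₂ : 0 ≤ Q.2)
    (h : d.1 / P.1 * Q.1 + d.2 / P.2 * Q.2 ≤ d.1 + d.2) : monomial d Q ≤ monomial d P := by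
  have aux : ∀ {x s : ℝ}, 0 ≤ x → 0 ≤ s → x ^ s ≤ Real.exp (s * (x - 1)) := by
    intro x s hx hs
    rw [mul_comm, Real.exp_mul]
    exact Real.rpow_le_rpow hx (by linarith [Real.add_one_le_exp (x - 1)]) hs
  have hx : 0 ≤ Q.1 / P.1 := by positivity
  have hy : 0 ≤ Q.2 / P.2 := by positivity
  have e1 : Q.1 ^ d.1 = (Q.1 / P.1) ^ d.1 * P.1 ^ d.1 := by
    rw [← Real.mul_rpow hx hP₁.le, div_mul_cancel₀ _ hP₁.ne']
  have e2 : Q.2 ^ d.2 = (Q.2 / P.2) ^ d.2 * P.2 ^ d.2 := by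
    rw [← Real.mul_rpow hy hP₂.le, div_mul_cancel₀ _ hP₂.ne']
  have hle : (Q.1 / P.1) ^ d.1 * (Q.2 / P.2) ^ d.2 ≤ 1 := by
    calc (Q.1 / P.1) ^ d.1 * (Q.2 / P.2) ^ d.2
        ≤ Real.exp (d.1 * (Q.1 / P.1 - 1)) * Real.exp (d.2 * (Q.2 / P.2 - 1)) := by
          gcongr
          · exact aux hx hd₁
          · exact aux hy hd₂
      _ = Real.exp (d.1 / P.1 * Q.1 + d.2 / P.2 * Q.2 - (d.1 + d.2)) := by
          rw [← Real.exp_add]; congr 1; ring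
      _ ≤ 1 := Real.exp_le_one_iff.2 (by linarith)
  have hpos : 0 < monomial d P := mul_pos (Real.rpow_pos_of_pos hP₁ _) (Real.rpow_pos_of_pos hP₂ _)
  calc monomial d Q = ((Q.1 / P.1) ^ d.1 * (Q.2 / P.2) ^ d.2) * monomial d P := by
        simp only [monomial, e1, e2]; ring
    _ ≤ 1 * monomial d P := by gcongr
    _ = _ := one_mul _

section Cones

variable {m : ℕ} {a b : Fin m → ℝ}

/-- Multiplying by `d.1 + d.2` makes the condition `critPt ∈ M` linear in `d`, so `K_i` is
polyhedral. -/
theorem factor_critPt_mul (ha : ∀ i, 0 < a i) (hb : ∀ i, 0 < b i) (i k : Fin m) {d : ℝ × ℝ}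
    (hd : d.1 + d.2 ≠ 0) :
    factor (a k) (b k) (critPt a b i d).1 (critPt a b i d).2 * (d.1 + d.2) =
      (1 - a k / a i) * d.1 + (1 - b k / b i) * d.2 := by
  have := (ha i).ne'
  have := (hb i).ne'
  simp only [factor, critPt]
  field_simp
  ring

theorem nonneg_of_mem_coneK (ha : ∀ i, 0 < a i) (hb : ∀ i, 0 < b i) {i : Fin m} (k : Fin m)
    {d : ℝ × ℝ} (hd : d ∈ coneK a b i) :
    0 ≤ (1 - a k / a i) * d.1 + (1 - b k / b i) * d.2 := by
  obtain ⟨h1, h2, h3, -⟩ := hd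
  rcases eq_or_ne (d.1 + d.2) 0 with h0 | h0
  · have e1 : d.1 = 0 := by linarith
    have e2 : d.2 = 0 := by linarith
    simp [e1, e2]
  · rw [← factor_critPt_mul ha hb i k h0]
    exact mul_nonneg (h3.1.2.2 k) (by linarith)

/-- The level curve of the monomial through `critPt` is tangent to the line `Q_i = 0`. The maximum
is therefore attained over the whole region `Q_i ≥ 0` of the quadrant, which contains both `M` and
the segment. -/
theorem mem_coneK_of_nonneg (ha : ∀ i, 0 < a i) (hb : ∀ i, 0 < b i) {i : Fin m} {d : ℝ × ℝ}
    (h₁ : 0 < d.1) (h₂ : 0 < d.2)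
    (h : ∀ k, 0 ≤ (1 - a k / a i) * d.1 + (1 - b k / b i) * d.2) : d ∈ coneK a b i := by
  have hn : 0 < d.1 + d.2 := by linarith
  have hai := ha i
  have hbi := hb i
  have c1 : 0 < (critPt a b i d).1 := by unfold critPt; positivity
  have c2 : 0 < (critPt a b i d).2 := by unfold critPt; positivity
  have hmax : ∀ Q : ℝ × ℝ, 0 ≤ Q.1 → 0 ≤ Q.2 → 0 ≤ factor (a i) (b i) Q.1 Q.2 →
      monomial d Q ≤ monomial d (critPt a b i d) := by
    intro Q hQ1 hQ2 hQ
    refine monomial_le_of_tangent h₁.le h₂.le c1 c2 hQ1 hQ2 ?_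
    have e : d.1 / (critPt a b i d).1 * Q.1 + d.2 / (critPt a b i d).2 * Q.2 =
        (d.1 + d.2) * (a i * Q.1 + b i * Q.2) := by
      simp only [critPt]; field_simp
    rw [e]
    simp only [factor] at hQ
    nlinarith
  refine ⟨h₁.le, h₂.le, ⟨⟨c1.le, c2.le, fun k => ?_⟩, c1.le, c2.le, ?_⟩, ?_, ?_⟩
  · have := h k
    rw [← factor_critPt_mul ha hb i k hn.ne'] at this
    exact nonneg_of_mul_nonneg_left this hn
  · exact (critPt_spec a b i d hai.ne' hbi.ne' hn.ne').1
  · exact fun Q hQ => hmax Q hQ.1 hQ.2.1 (hQ.2.2 i)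
  · exact fun Q hQ => hmax Q hQ.1 hQ.2.1 hQ.2.2.ge

theorem GeneralPosition.normal_ne (hgp : GeneralPosition a b) (ha : ∀ i, 0 < a i)
    (hb : ∀ i, 0 < b i) {i k : Fin m} (hki : k ≠ i) :
    ¬ (1 - a k / a i = 0 ∧ 1 - b k / b i = 0) := by
  rintro ⟨h1, h2⟩
  have e1 : a k = a i := by
    rw [sub_eq_zero, eq_comm, div_eq_one_iff_eq (ha i).ne'] at h1; exact h1
  have e2 : b k = b i := by
    rw [sub_eq_zero, eq_comm, div_eq_one_iff_eq (hb i).ne'] at h2; exact h2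
  exact hgp.pair k i hki (by simp [Delta, e1, e2])

theorem pos_of_mem_interior_coneK (hgp : GeneralPosition a b) (ha : ∀ i, 0 < a i)
    (hb : ∀ i, 0 < b i) {i k : Fin m} (hki : k ≠ i) {d : ℝ × ℝ}
    (hd : d ∈ interior (coneK a b i)) :
    0 < factor (a k) (b k) (critPt a b i d).1 (critPt a b i d).2 := by
  have h1 : 0 < d.1 := fst_pos_of_mem_interior (fun d hd => hd.1) hd
  have h2 : 0 < d.2 := snd_pos_of_mem_interior (fun d hd => hd.2.1) hd
  have h3 := pos_of_mem_interior_of_subset (hgp.normal_ne ha hb hki)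
    (fun d hd => nonneg_of_mem_coneK ha hb k hd) hd
  rw [← factor_critPt_mul ha hb i k (by linarith)] at h3
  exact pos_of_mul_pos_left h3 (by linarith)

theorem mem_interior_coneK_of_pos (ha : ∀ i, 0 < a i) (hb : ∀ i, 0 < b i) {i : Fin m} {d : ℝ × ℝ}
    (h₁ : 0 < d.1) (h₂ : 0 < d.2)
    (h : ∀ k, k ≠ i → 0 < (1 - a k / a i) * d.1 + (1 - b k / b i) * d.2) :
    d ∈ interior (coneK a b i) := by
  rw [mem_interior_iff_mem_nhds]
  have e1 : ∀ᶠ d' : ℝ × ℝ in 𝓝 d, 0 < d'.1 := continuous_fst.continuousAt.eventually_const_lt h₁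
  have e2 : ∀ᶠ d' : ℝ × ℝ in 𝓝 d, 0 < d'.2 := continuous_snd.continuousAt.eventually_const_lt h₂
  have e3 : ∀ᶠ d' : ℝ × ℝ in 𝓝 d, ∀ k, k ≠ i →
      0 < (1 - a k / a i) * d'.1 + (1 - b k / b i) * d'.2 := by
    rw [eventually_all]
    intro k
    by_cases hk : k = i
    · simp [hk]
    · have hc : Continuous fun d' : ℝ × ℝ => (1 - a k / a i) * d'.1 + (1 - b k / b i) * d'.2 := by
        fun_prop
      filter_upwards [hc.continuousAt.eventually_const_lt (h k hk)] with d' hd' _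
      exact hd'
  filter_upwards [e1, e2, e3] with d' h1 h2 h3
  refine mem_coneK_of_nonneg ha hb h1 h2 fun k => ?_
  rcases eq_or_ne k i with rfl | hk
  · simp [div_self (ha k).ne', div_self (hb k).ne']
  · exact (h3 k hk).le

theorem eventually_add_smul_mem_polygon {P v : ℝ × ℝ} (hP : P ∈ polygon a b) (h₁ : 0 < P.1)
    (h₂ : 0 < P.2)
    (hv : ∀ k, factor (a k) (b k) P.1 P.2 = 0 → a k * v.1 + b k * v.2 ≤ 0) :
    ∀ᶠ t : ℝ in 𝓝[>] 0, (P.1 + t * v.1, P.2 + t * v.2) ∈ polygon a b := by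
  have c1 : Continuous fun t : ℝ => P.1 + t * v.1 := by fun_prop
  have c2 : Continuous fun t : ℝ => P.2 + t * v.2 := by fun_prop
  have e1 : ∀ᶠ t : ℝ in 𝓝 0, 0 < P.1 + t * v.1 :=
    c1.continuousAt.eventually_const_lt (by simpa using h₁)
  have e2 : ∀ᶠ t : ℝ in 𝓝 0, 0 < P.2 + t * v.2 :=
    c2.continuousAt.eventually_const_lt (by simpa using h₂)
  have e3 : ∀ᶠ t : ℝ in 𝓝[>] 0, ∀ k, 0 ≤ factor (a k) (b k) (P.1 + t * v.1) (P.2 + t * v.2) := by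
    rw [eventually_all]
    intro k
    rcases (hP.2.2 k).eq_or_lt with h0 | h0
    · filter_upwards [self_mem_nhdsWithin] with t (ht : 0 < t)
      have := hv k h0.symm
      simp only [factor] at h0 ⊢
      nlinarith
    · have c3 : Continuous fun t : ℝ => factor (a k) (b k) (P.1 + t * v.1) (P.2 + t * v.2) := by
        simp only [factor]; fun_prop
      have e4 : ∀ᶠ t : ℝ in 𝓝 0, 0 < factor (a k) (b k) (P.1 + t * v.1) (P.2 + t * v.2) :=
        c3.continuousAt.eventually_const_lt (by simpa using h0)
      exact nhdsWithin_le_nhds (e4.mono fun t ht => ht.le)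
  filter_upwards [nhdsWithin_le_nhds e1, nhdsWithin_le_nhds e2, e3] with t t1 t2 t3
  exact ⟨t1.le, t2.le, t3⟩

/-- The first-order condition at a maximum over the polygon. -/
theorem directional_nonpos {d P v : ℝ × ℝ} (hP : P ∈ polygon a b) (h₁ : 0 < P.1)
    (h₂ : 0 < P.2) (hmax : IsMaxOn (monomial d) (polygon a b) P)
    (hv : ∀ k, factor (a k) (b k) P.1 P.2 = 0 → a k * v.1 + b k * v.2 ≤ 0) :
    d.1 * v.1 * P.2 + d.2 * v.2 * P.1 ≤ 0 := by
  by_contra! hpos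
  have g1 : HasDerivAt (fun t : ℝ => P.1 + t * v.1) (1 * v.1) 0 :=
    ((hasDerivAt_id (0 : ℝ)).mul_const v.1).const_add P.1
  have g2 : HasDerivAt (fun t : ℝ => P.2 + t * v.2) (1 * v.2) 0 :=
    ((hasDerivAt_id (0 : ℝ)).mul_const v.2).const_add P.2
  have g := (g1.rpow_const (p := d.1) (Or.inl (by simpa using h₁.ne'))).mul
    (g2.rpow_const (p := d.2) (Or.inl (by simpa using h₂.ne')))
  have hD : 0 < 1 * v.1 * d.1 * (P.1 + 0 * v.1) ^ (d.1 - 1) * (P.2 + 0 * v.2) ^ d.2 +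
      (P.1 + 0 * v.1) ^ d.1 * (1 * v.2 * d.2 * (P.2 + 0 * v.2) ^ (d.2 - 1)) := by
    simp only [zero_mul, add_zero, one_mul]
    rw [Real.rpow_sub_one h₁.ne', Real.rpow_sub_one h₂.ne']
    have p1 := Real.rpow_pos_of_pos h₁ d.1
    have p2 := Real.rpow_pos_of_pos h₂ d.2
    have : v.1 * d.1 * (P.1 ^ d.1 / P.1) * P.2 ^ d.2 + P.1 ^ d.1 * (v.2 * d.2 * (P.2 ^ d.2 / P.2)) =
        P.1 ^ d.1 * P.2 ^ d.2 / (P.1 * P.2) * (d.1 * v.1 * P.2 + d.2 * v.2 * P.1) := by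
      field_simp
    rw [this]
    positivity
  have ev := eventually_lt_of_hasDerivAt_pos g hD
  obtain ⟨t, ht, htM⟩ := (ev.and (eventually_add_smul_mem_polygon hP h₁ h₂ hv)).exists
  have := hmax htM
  simp only [Set.mem_ofPred_eq, monomial, zero_mul, add_zero, Pi.mul_apply] at this ht
  linarith

theorem isSide_of_direction {P v : ℝ × ℝ} {i : Fin m} (hP : P ∈ polygon a b) (h₁ : 0 < P.1)
    (h₂ : 0 < P.2) (hi : factor (a i) (b i) P.1 P.2 = 0) (hvi : a i * v.1 + b i * v.2 = 0)
    (hv0 : v.1 ≠ 0)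
    (hv : ∀ k, factor (a k) (b k) P.1 P.2 = 0 → a k * v.1 + b k * v.2 ≤ 0) : IsSide a b i := by
  obtain ⟨t, ht, ht0 : 0 < t⟩ :=
    ((eventually_add_smul_mem_polygon hP h₁ h₂ hv).and self_mem_nhdsWithin).exists
  refine ⟨P, ⟨⟨hP.1, hP.2.1, hi⟩, hP⟩, _, ⟨⟨ht.1, ht.2.1, ?_⟩, ht⟩, ?_⟩
  · simp only [factor] at hi ⊢
    linear_combination hi - t * hvi
  · intro h
    have := congrArg Prod.fst h
    simp only [left_eq_add, mul_eq_zero] at this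
    exact this.elim ht0.ne' hv0

/-- A maximum of a monomial with positive exponents over the polygon lies in the open quadrant. -/
theorem pos_of_isMaxOn {d P : ℝ × ℝ} (hd₁ : 0 < d.1)
    (hd₂ : 0 < d.2) (hP : P ∈ polygon a b) (hmax : IsMaxOn (monomial d) (polygon a b) P) :
    0 < P.1 ∧ 0 < P.2 := by
  have hev : ∀ᶠ t : ℝ in 𝓝[>] 0, ∀ k, 0 ≤ factor (a k) (b k) t t := by
    rw [eventually_all]
    intro k
    have c : Continuous fun t : ℝ => factor (a k) (b k) t t := by simp only [factor]; fun_prop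
    have : ∀ᶠ t : ℝ in 𝓝 0, 0 < factor (a k) (b k) t t :=
      c.continuousAt.eventually_const_lt (by simp [factor])
    exact nhdsWithin_le_nhds (this.mono fun t ht => ht.le)
  obtain ⟨t, ht, ht0 : 0 < t⟩ := (hev.and self_mem_nhdsWithin).exists
  have hle : monomial d (t, t) ≤ monomial d P := hmax (show (t, t) ∈ polygon a b from
    ⟨ht0.le, ht0.le, ht⟩)
  have hpos : 0 < monomial d P := lt_of_lt_of_le
    (mul_pos (Real.rpow_pos_of_pos ht0 _) (Real.rpow_pos_of_pos ht0 _)) hle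
  refine ⟨hP.1.lt_of_ne fun h => ?_, hP.2.1.lt_of_ne fun h => ?_⟩
  · simp [monomial, ← h, Real.zero_rpow hd₁.ne'] at hpos
  · simp [monomial, ← h, Real.zero_rpow hd₂.ne'] at hpos

theorem eq_or_eq_of_factor_eq_zero (hgp : GeneralPosition a b) {i j k : Fin m} (hij : i ≠ j)
    {P : ℝ × ℝ} (hi : factor (a i) (b i) P.1 P.2 = 0) (hj : factor (a j) (b j) P.1 P.2 = 0)
    (hk : factor (a k) (b k) P.1 P.2 = 0) : k = i ∨ k = j := by
  by_contra! h
  exact hgp.factor_ne_zero hij h.1 h.2 hi hj hk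

/-- The first-order condition is tested along the two edges at the vertex. `Δ < 0` fixes their
orientation: `(-b i, a i)` and `(b j, -a j)` do not leave the half-plane of the other line. -/
theorem inequalities_of_mem_coneOmega (hgp : GeneralPosition a b) {i j : Fin m}
    (hΔ : Delta a b i j < 0) (h₁ : 0 < (crossPt a b i j).1) (h₂ : 0 < (crossPt a b i j).2)
    {d : ℝ × ℝ} (hd : d ∈ coneOmega a b i j) :
    0 ≤ b i * (crossPt a b i j).2 * d.1 + -(a i * (crossPt a b i j).1) * d.2 ∧
      0 ≤ -(b j * (crossPt a b i j).2) * d.1 + a j * (crossPt a b i j).1 * d.2 := by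
  obtain ⟨-, -, hP, hmax⟩ := hd
  obtain ⟨hi, hj⟩ := crossPt_spec a b i j hΔ.ne
  have hij : i ≠ j := by rintro rfl; simp [Delta] at hΔ
  have hact := fun k hk => eq_or_eq_of_factor_eq_zero hgp (k := k) hij hi hj hk
  have hΔ' : a i * b j - a j * b i < 0 := hΔ
  constructor
  · have := directional_nonpos (v := (-b i, a i)) hP h₁ h₂ hmax fun k hk => by
      rcases hact k hk with rfl | rfl
      · simp only; linarith
      · simp only; linarith
    simp only at this
    linarith
  · have := directional_nonpos (v := (b j, -a j)) hP h₁ h₂ hmax fun k hk => by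
      rcases hact k hk with rfl | rfl
      · simp only; linarith
      · simp only; linarith
    simp only at this
    linarith

/-- Lagrange multipliers: Cramer's rule writes the logarithmic gradient `(d.1 / P.1, d.2 / P.2)` as
`A (a i, b i) + B (a j, b j)`, and the two inequalities say `A, B ≥ 0`. The tangent-line inequality
is then `A Q_i + B Q_j ≥ 0`. -/
theorem mem_coneOmega_of_inequalities {i j : Fin m} (hΔ : Delta a b i j < 0)
    (hP : crossPt a b i j ∈ polygon a b) (h₁ : 0 < (crossPt a b i j).1)
    (h₂ : 0 < (crossPt a b i j).2) {d : ℝ × ℝ} (hd₁ : 0 ≤ d.1) (hd₂ : 0 ≤ d.2)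
    (hlo : 0 ≤ b i * (crossPt a b i j).2 * d.1 + -(a i * (crossPt a b i j).1) * d.2)
    (hhi : 0 ≤ -(b j * (crossPt a b i j).2) * d.1 + a j * (crossPt a b i j).1 * d.2) :
    d ∈ coneOmega a b i j := by
  refine ⟨hd₁, hd₂, hP, fun Q hQ => ?_⟩
  obtain ⟨hi, hj⟩ := crossPt_spec a b i j hΔ.ne
  set P := crossPt a b i j
  refine monomial_le_of_tangent hd₁ hd₂ h₁ h₂ hQ.1 hQ.2.1 ?_
  have qi := hQ.2.2 i
  have qj := hQ.2.2 j
  simp only [factor] at hi hj qi qj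
  set D := Delta a b i j with hD
  have hD' : a i * b j - a j * b i = D := rfl
  set A := (d.1 / P.1 * b j - d.2 / P.2 * a j) / D with hA
  set B := (a i * (d.2 / P.2) - b i * (d.1 / P.1)) / D with hB
  have A0 : 0 ≤ A := by
    refine div_nonneg_of_nonpos ?_ hΔ.le
    have : d.1 / P.1 * b j - d.2 / P.2 * a j =
      -((-(b j * P.2) * d.1 + a j * P.1 * d.2) / (P.1 * P.2)) := by field_simp; ring
    rw [this]
    exact neg_nonpos.2 (div_nonneg hhi (by positivity))
  have B0 : 0 ≤ B := by
    refine div_nonneg_of_nonpos ?_ hΔ.le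
    have : a i * (d.2 / P.2) - b i * (d.1 / P.1) =
      -((b i * P.2 * d.1 + -(a i * P.1) * d.2) / (P.1 * P.2)) := by field_simp; ring
    rw [this]
    exact neg_nonpos.2 (div_nonneg hlo (by positivity))
  have hAD : A * D = d.1 / P.1 * b j - d.2 / P.2 * a j := div_mul_cancel₀ _ hΔ.ne
  have hBD : B * D = a i * (d.2 / P.2) - b i * (d.1 / P.1) := div_mul_cancel₀ _ hΔ.ne
  have e1 : d.1 / P.1 = A * a i + B * a j := by
    apply mul_right_cancel₀ hΔ.ne
    linear_combination -a i * hAD - a j * hBD - d.1 / P.1 * hD'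
  have e2 : d.2 / P.2 = A * b i + B * b j := by
    apply mul_right_cancel₀ hΔ.ne
    linear_combination -b i * hAD - b j * hBD - d.2 / P.2 * hD'
  have e3 : d.1 + d.2 = A + B := by
    have : d.1 + d.2 = d.1 / P.1 * P.1 + d.2 / P.2 * P.2 := by
      rw [div_mul_cancel₀ _ h₁.ne', div_mul_cancel₀ _ h₂.ne']
    rw [this, e1, e2]
    linear_combination -A * hi - B * hj
  rw [e1, e2, e3]
  nlinarith [mul_nonneg A0 qi, mul_nonneg B0 qj]

theorem mem_interior_coneOmega {i j : Fin m} (hΔ : Delta a b i j < 0)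
    (hP : crossPt a b i j ∈ polygon a b) (h₁ : 0 < (crossPt a b i j).1)
    (h₂ : 0 < (crossPt a b i j).2) {d : ℝ × ℝ} (hd₁ : 0 < d.1) (hd₂ : 0 < d.2)
    (hlo : 0 < b i * (crossPt a b i j).2 * d.1 + -(a i * (crossPt a b i j).1) * d.2)
    (hhi : 0 < -(b j * (crossPt a b i j).2) * d.1 + a j * (crossPt a b i j).1 * d.2) :
    d ∈ interior (coneOmega a b i j) := by
  rw [mem_interior_iff_mem_nhds]
  have lin : ∀ x y : ℝ, 0 < x * d.1 + y * d.2 → ∀ᶠ d' : ℝ × ℝ in 𝓝 d, 0 < x * d'.1 + y * d'.2 := by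
    intro x y h
    have hc : Continuous fun d' : ℝ × ℝ => x * d'.1 + y * d'.2 := by fun_prop
    exact hc.continuousAt.eventually_const_lt h
  filter_upwards [continuous_fst.continuousAt.eventually_const_lt hd₁,
    continuous_snd.continuousAt.eventually_const_lt hd₂, lin _ _ hlo, lin _ _ hhi] with d' g1 g2 g3 g4
  exact mem_coneOmega_of_inequalities hΔ hP h₁ h₂ g1.le g2.le g3.le g4.le

/-! ### The cones cover the open quadrant. -/

theorem isCompact_polygon (hm : 1 ≤ m) (ha : ∀ i, 0 < a i) (hb : ∀ i, 0 < b i) :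
    IsCompact (polygon a b) := by
  have hclosed : IsClosed (polygon a b) := by
    have : polygon a b = {P : ℝ × ℝ | 0 ≤ P.1} ∩ {P | 0 ≤ P.2} ∩
        ⋂ i, {P | 0 ≤ factor (a i) (b i) P.1 P.2} := by
      ext P
      simp [polygon, and_assoc]
    rw [this]
    refine ((isClosed_le continuous_const continuous_fst).inter
      (isClosed_le continuous_const continuous_snd)).inter
      (isClosed_iInter fun i => isClosed_le continuous_const ?_)
    simp only [factor]; fun_prop
  let i0 : Fin m := ⟨0, hm⟩
  refine (isCompact_Icc (a := ((0 : ℝ), (0 : ℝ))) (b := (1 / a i0, 1 / b i0))).of_isClosed_subset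
    hclosed fun P hP => ?_
  have h := hP.2.2 i0
  simp only [factor] at h
  have p1 := mul_nonneg (ha i0).le hP.1
  have p2 := mul_nonneg (hb i0).le hP.2.1
  refine ⟨⟨hP.1, hP.2.1⟩, ?_, ?_⟩
  · simp only; rw [le_div_iff₀ (ha i0)]; linarith
  · simp only; rw [le_div_iff₀ (hb i0)]; linarith

theorem exists_isMaxOn_polygon (hm : 1 ≤ m) (ha : ∀ i, 0 < a i) (hb : ∀ i, 0 < b i) {d : ℝ × ℝ}
    (h₁ : 0 ≤ d.1) (h₂ : 0 ≤ d.2) :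
    ∃ P ∈ polygon a b, IsMaxOn (monomial d) (polygon a b) P := by
  refine (isCompact_polygon hm ha hb).exists_isMaxOn ⟨(0, 0), le_rfl, le_rfl, by simp [factor]⟩ ?_
  exact ((continuous_fst.rpow_const fun _ => Or.inr h₁).mul
    (continuous_snd.rpow_const fun _ => Or.inr h₂)).continuousOn

theorem eq_crossPt {i j : Fin m} (hΔ : Delta a b i j ≠ 0) {P : ℝ × ℝ}
    (hi : factor (a i) (b i) P.1 P.2 = 0) (hj : factor (a j) (b j) P.1 P.2 = 0) :
    P = crossPt a b i j := by
  simp only [factor] at hi hj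
  ext
  · simp only [crossPt]
    rw [eq_div_iff hΔ, Delta]
    linear_combination b i * hj - b j * hi
  · simp only [crossPt]
    rw [eq_div_iff hΔ, Delta]
    linear_combination a j * hi - a i * hj

/-- Of the two directions along line `i`, one does not leave the half-plane `Q_j ≥ 0`; the sign of
`Δ_{ij}` tells which. -/
theorem isSide_of_vertex (hgp : GeneralPosition a b) (hb : ∀ i, 0 < b i)
    {i j : Fin m} (hij : i ≠ j) {P : ℝ × ℝ} (hP : P ∈ polygon a b) (h₁ : 0 < P.1) (h₂ : 0 < P.2)
    (hi : factor (a i) (b i) P.1 P.2 = 0) (hj : factor (a j) (b j) P.1 P.2 = 0) :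
    IsSide a b i := by
  have hact := fun k hk => eq_or_eq_of_factor_eq_zero hgp (k := k) hij hi hj hk
  rcases le_total (a i * b j) (a j * b i) with hle | hle
  · refine isSide_of_direction (v := (-b i, a i)) hP h₁ h₂ hi (by simp only; ring)
      (neg_ne_zero.2 (hb i).ne') fun k hk => ?_
    rcases hact k hk with rfl | rfl <;> simp only <;> linarith
  · refine isSide_of_direction (v := (b i, -a i)) hP h₁ h₂ hi (by simp only; ring)
      (hb i).ne' fun k hk => ?_
    rcases hact k hk with rfl | rfl <;> simp only <;> linarith

/-- A line whose slope lies strictly between those of two lines meeting at a vertex of the polygon,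
and which does not pass through the vertex, carries no side. -/
theorem not_isSide_between (hb : ∀ i, 0 < b i) {i j k : Fin m} {P : ℝ × ℝ}
    (hi : factor (a i) (b i) P.1 P.2 = 0) (hj : factor (a j) (b j) P.1 P.2 = 0)
    (hk : 0 < factor (a k) (b k) P.1 P.2) (hik : a i / b i < a k / b k)
    (hkj : a k / b k < a j / b j) : ¬ IsSide a b k := by
  rw [div_lt_div_iff₀ (hb _) (hb _)] at hik hkj
  rintro ⟨Q, ⟨hQk, hQ⟩, -⟩
  have qi := hQ.2.2 i
  have qj := hQ.2.2 j
  have qk := hQk.2.2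
  have hD : a i * b j < a j * b i := by
    have := hb k
    by_contra! h
    nlinarith [mul_lt_mul_of_pos_right hik (hb j), mul_lt_mul_of_pos_right hkj (hb i),
      mul_le_mul_of_nonneg_right h (hb k).le]
  set A := a j * b k - a k * b j with hA
  set B := a k * b i - a i * b k with hB
  have A0 : 0 < A := by linarith
  have B0 : 0 < B := by linarith
  -- The normal of line `k` is a positive combination of the other two. At `P` the relation makes
  -- its constant term positive; at `Q` all other terms on the right are nonnegative while the left
  -- side is zero.
  have e1 : (a j * b i - a i * b j) * factor (a k) (b k) P.1 P.2 =
      A * factor (a i) (b i) P.1 P.2 + B * factor (a j) (b j) P.1 P.2 +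
        ((a j * b i - a i * b j) - A - B) := by
    simp only [factor, hA, hB]; ring
  have e2 : (a j * b i - a i * b j) * factor (a k) (b k) Q.1 Q.2 =
      A * factor (a i) (b i) Q.1 Q.2 + B * factor (a j) (b j) Q.1 Q.2 +
        ((a j * b i - a i * b j) - A - B) := by
    simp only [factor, hA, hB]; ring
  rw [hi, hj] at e1
  rw [qk] at e2
  have := mul_pos (sub_pos.2 hD) hk
  nlinarith [mul_nonneg A0.le qi, mul_nonneg B0.le qj]

theorem Delta_neg_of_lt {r : ℕ} (hb : ∀ i, 0 < b i) (hnum : SidesFirst a b r) {i j : Fin m}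
    (hij : i < j) (hj : j.val < r) : Delta a b i j < 0 := by
  have := hnum.increasing i j hij hj
  rw [div_lt_div_iff₀ (hb _) (hb _)] at this
  simp only [Delta]
  linarith

/-- Every direction in the open quadrant lies in one of the cones. -/
theorem exists_mem_cone {r : ℕ} (hm : 1 ≤ m) (ha : ∀ i, 0 < a i) (hb : ∀ i, 0 < b i)
    (hgp : GeneralPosition a b) (hnum : SidesFirst a b r) {d : ℝ × ℝ} (h₁ : 0 < d.1)
    (h₂ : 0 < d.2) :
    (∃ i : Fin m, i.val < r ∧ d ∈ coneK a b i) ∨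
      ∃ i j : Fin m, j.val = i.val + 1 ∧ j.val < r ∧ d ∈ coneOmega a b i j := by
  obtain ⟨P, hP, hmax⟩ := exists_isMaxOn_polygon (d := d) hm ha hb h₁.le h₂.le
  obtain ⟨p1, p2⟩ := pos_of_isMaxOn h₁ h₂ hP hmax
  -- Off all the lines the monomial would increase in the direction `(1, 1)`.
  obtain ⟨i, hi⟩ : ∃ i, factor (a i) (b i) P.1 P.2 = 0 := by
    by_contra! h
    have := directional_nonpos (v := (1, 1)) hP p1 p2 hmax fun k hk => absurd hk (h k)
    have q1 := mul_pos h₁ p2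
    have q2 := mul_pos h₂ p1
    simp only at this
    linarith
  by_cases hone : ∀ k, factor (a k) (b k) P.1 P.2 = 0 → k = i
  · left
    have d1 := directional_nonpos (v := (b i, -a i)) hP p1 p2 hmax fun k hk => by
      rw [hone k hk]; simp only; linarith
    have d2 := directional_nonpos (v := (-b i, a i)) hP p1 p2 hmax fun k hk => by
      rw [hone k hk]; simp only; linarith
    simp only at d1 d2
    have hside : IsSide a b i := isSide_of_direction (v := (b i, -a i)) hP p1 p2 hi
      (by simp only; ring) (hb i).ne' fun k hk => by rw [hone k hk]; simp only; linarith
    -- Both directions along the line are admissible, so the derivative along it vanishes; with `Q_i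
    -- = 0` this determines the critical point.
    have hcrit : P = critPt a b i d := by
      have hai := ha i
      have hbi := hb i
      have heq : d.1 * b i * P.2 = d.2 * a i * P.1 := by linarith
      simp only [factor] at hi
      ext
      · simp only [critPt]
        rw [eq_div_iff (by positivity)]
        linear_combination -d.1 * hi - heq
      · simp only [critPt]
        rw [eq_div_iff (by positivity)]
        linear_combination -d.2 * hi + heq
    refine ⟨i, (hnum.side_iff i).1 hside, mem_coneK_of_nonneg ha hb h₁ h₂ fun k => ?_⟩
    rw [← factor_critPt_mul ha hb i k (by linarith), ← hcrit]
    exact mul_nonneg (hP.2.2 k) (by linarith)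
  · right
    push Not at hone
    obtain ⟨j, hj, hji⟩ := hone
    have main : ∀ i j : Fin m, i < j → factor (a i) (b i) P.1 P.2 = 0 →
        factor (a j) (b j) P.1 P.2 = 0 →
        ∃ i j : Fin m, j.val = i.val + 1 ∧ j.val < r ∧ d ∈ coneOmega a b i j := by
      intro i j hij hi hj
      have hjr := (hnum.side_iff j).1 (isSide_of_vertex hgp hb hij.ne' hP p1 p2 hj hi)
      -- An index strictly between would be a side of intermediate slope missing the vertex, which
      -- `not_isSide_between` excludes.
      have hcons : j.val = i.val + 1 := by
        by_contra hne
        have hlt : i.val < j.val := hij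
        let k : Fin m := ⟨i.val + 1, by omega⟩
        have hik : i < k := Nat.lt_succ_self _
        have hkj : k < j := by
          change i.val + 1 < j.val
          omega
        have hkr : k.val < r := lt_trans hkj hjr
        refine not_isSide_between hb hi hj ?_ (hnum.increasing i k hik hkr)
          (hnum.increasing k j hkj hjr) ((hnum.side_iff k).2 hkr)
        exact (hP.2.2 k).lt_of_ne (hgp.factor_ne_zero hij.ne hik.ne' hkj.ne hi hj).symm
      refine ⟨i, j, hcons, hjr, h₁.le, h₂.le, ?_⟩
      rw [← eq_crossPt (hgp.pair i j hij.ne) hi hj]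
      exact ⟨hP, hmax⟩
    rcases lt_or_gt_of_ne hji with h | h
    · exact main j i h hj hi
    · exact main i j h hi hj

/-! ### Boundary rays of the cones. -/

/-- Generators of the rays that carry the boundaries of the cones. -/
def boundaryRays (a b : Fin m → ℝ) : Set (ℝ × ℝ) :=
  {(1, 0), (0, 1)} ∪
    (Set.range (fun x : Fin m × Fin m =>
      (1 - b x.2 / b x.1, -(1 - a x.2 / a x.1))) ∪
    Set.range (fun x : Fin m × Fin m =>
      (-(1 - b x.2 / b x.1), 1 - a x.2 / a x.1))) ∪
    (Set.range (fun x : Fin m × Fin m =>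
      (a x.1 * (crossPt a b x.1 x.2).1, b x.1 * (crossPt a b x.1 x.2).2)) ∪
    Set.range (fun x : Fin m × Fin m =>
      (a x.2 * (crossPt a b x.1 x.2).1, b x.2 * (crossPt a b x.1 x.2).2)))

theorem finite_boundaryRays (a b : Fin m → ℝ) : (boundaryRays a b).Finite := by
  unfold boundaryRays
  exact ((Set.toFinite _).union ((Set.finite_range _).union (Set.finite_range _))).union
    ((Set.finite_range _).union (Set.finite_range _))

/-- The kernel of a linear form is a full line, hence two opposite rays; this is why both signs
occur in `boundaryRays`. -/
theorem exists_smul_of_ker {x y : ℝ} (hxy : ¬ (x = 0 ∧ y = 0)) {d : ℝ × ℝ} (h₁ : 0 < d.1)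
    (h : x * d.1 + y * d.2 = 0) :
    ∃ t : ℝ, 0 ≤ t ∧ (d = t • (y, -x) ∨ d = t • (-y, x)) := by
  have hy : y ≠ 0 := by
    rintro rfl
    refine hxy ⟨?_, rfl⟩
    simpa [h₁.ne'] using h
  have h2 : d.2 = -(x * d.1) / y := by rw [eq_div_iff hy]; linarith
  rcases lt_or_gt_of_ne hy with hneg | hpos
  · refine ⟨d.1 / -y, div_nonneg h₁.le (by linarith), Or.inr ?_⟩
    ext
    · simp only [Prod.smul_mk, smul_eq_mul]; field_simp
    · simp only [Prod.smul_mk, smul_eq_mul]; rw [h2]; field_simp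
  · refine ⟨d.1 / y, div_nonneg h₁.le hpos.le, Or.inl ?_⟩
    ext
    · simp only [Prod.smul_mk, smul_eq_mul]; field_simp
    · simp only [Prod.smul_mk, smul_eq_mul]; rw [h2]; field_simp

theorem exists_smul_of_proportional {x y : ℝ} (hx : 0 < x) {d : ℝ × ℝ} (h₁ : 0 < d.1)
    (h : y * d.1 = x * d.2) : ∃ t : ℝ, 0 ≤ t ∧ d = t • (x, y) := by
  refine ⟨d.1 / x, by positivity, ?_⟩
  ext
  · simp only [Prod.smul_mk, smul_eq_mul]; field_simp
  · simp only [Prod.smul_mk, smul_eq_mul]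
    field_simp
    linarith

theorem mem_interior_coneK_of_offRays (ha : ∀ i, 0 < a i) (hb : ∀ i, 0 < b i)
    (hgp : GeneralPosition a b) {d : ℝ × ℝ}
    (hoff : ∀ e ∈ boundaryRays a b, ∀ t : ℝ, 0 ≤ t → d ≠ t • e) (h₁ : 0 < d.1) (h₂ : 0 < d.2)
    {i : Fin m} (hd : d ∈ coneK a b i) : d ∈ interior (coneK a b i) := by
  refine mem_interior_coneK_of_pos ha hb h₁ h₂ fun k hk =>
    (nonneg_of_mem_coneK ha hb k hd).lt_of_ne fun h0 => ?_
  obtain ⟨t, ht, h | h⟩ := exists_smul_of_ker (hgp.normal_ne ha hb hk) h₁ h0.symm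
  · exact hoff _ (Or.inl (Or.inr (Or.inl ⟨(i, k), rfl⟩))) t ht h
  · exact hoff _ (Or.inl (Or.inr (Or.inr ⟨(i, k), rfl⟩))) t ht h

theorem mem_interior_coneOmega_of_offRays (ha : ∀ i, 0 < a i)
    (hgp : GeneralPosition a b) {d : ℝ × ℝ}
    (hoff : ∀ e ∈ boundaryRays a b, ∀ t : ℝ, 0 ≤ t → d ≠ t • e) (h₁ : 0 < d.1) (h₂ : 0 < d.2)
    {i j : Fin m} (hΔ : Delta a b i j < 0) (hd : d ∈ coneOmega a b i j) :
    d ∈ interior (coneOmega a b i j) := by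
  obtain ⟨p1, p2⟩ := pos_of_isMaxOn h₁ h₂ hd.2.2.1 hd.2.2.2
  obtain ⟨hlo, hhi⟩ := inequalities_of_mem_coneOmega hgp hΔ p1 p2 hd
  refine mem_interior_coneOmega hΔ hd.2.2.1 p1 p2 h₁ h₂ (hlo.lt_of_ne fun h0 => ?_)
    (hhi.lt_of_ne fun h0 => ?_)
  · obtain ⟨t, ht, h⟩ := exists_smul_of_proportional (y := b i * (crossPt a b i j).2)
      (mul_pos (ha i) p1) h₁
      (by linarith)
    exact hoff _ (Or.inr (Or.inl ⟨(i, j), rfl⟩)) t ht h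
  · obtain ⟨t, ht, h⟩ := exists_smul_of_proportional (y := b j * (crossPt a b i j).2)
      (mul_pos (ha j) p1) h₁
      (by linarith)
    exact hoff _ (Or.inr (Or.inr ⟨(i, j), rfl⟩)) t ht h

end Cones

/-! ### Asymptotics inside the cones. -/

theorem isEquivalent_ofReal_of_tendsto {r D : ℕ → ℝ} {c : ℝ} (hc : c ≠ 0)
    (hD : ∀ᶠ k in atTop, D k ≠ 0) (h : Tendsto (fun k => r k * D k) atTop (𝓝 c)) :
    (fun k => (r k : ℂ)) ~[atTop] fun k => ((c * (1 / D k) : ℝ) : ℂ) := by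
  refine isEquivalent_of_tendsto_one ?_
  have h1 := (Complex.continuous_ofReal.tendsto _).comp (h.div_const c)
  rw [div_self hc, Complex.ofReal_one] at h1
  refine h1.congr' ?_
  filter_upwards [hD] with k hk
  simp only [Function.comp, Pi.div_apply]
  rw [← Complex.ofReal_div]
  congr 1
  field_simp

theorem asymptotics_coneK {m : ℕ} {a b : Fin m → ℝ} (ha : ∀ i, 0 < a i) (hb : ∀ i, 0 < b i)
    (hgp : GeneralPosition a b) {f : ℕ → ℕ → ℂ} (hf : IsTaylorCoeff (ratFun a b) f)
    {i : Fin m} {p q : ℕ} (hd : dir p q ∈ interior (coneK a b i)) :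
    ∃ c : ℝ, 0 < c ∧ (fun k : ℕ => f (k * p) (k * q)) ~[atTop] fun k : ℕ =>
      ((c / √(k : ℝ) * (1 / ((critPt a b i (dir p q)).1 ^ (k * p + 1) *
        (critPt a b i (dir p q)).2 ^ (k * q + 1))) : ℝ) : ℂ) := by
  have hp : 0 < p := Nat.cast_pos.1 (fst_pos_of_mem_interior (fun d hd => hd.1) hd)
  have hq : 0 < q := Nat.cast_pos.1 (snd_pos_of_mem_interior (fun d hd => hd.2.1) hd)
  have hP : critPt a b i (dir p q) = linCrit (a i) (b i) p q := rfl
  have hpos := fun k (hk : k ≠ i) => pos_of_mem_interior_coneK hgp ha hb hk hd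
  rw [hP] at hpos ⊢
  set P := linCrit (a i) (b i) p q with hPdef
  have P1 : 0 < P.1 := linCrit_fst_pos _ _ (ha i) hp
  have P2 : 0 < P.2 := linCrit_snd_pos _ _ (hb i) hq
  have ha' := fun i => (ha i).le
  have hb' := fun i => (hb i).le
  obtain ⟨e, he⟩ := exists_isProdCoeff ha' hb' ({i}ᶜ : Finset (Fin m))
  have hfe := taylorCoeff_eq_conv hf he (isProdCoeff_linCoeff ha' hb' i)
  have hmem : ∀ k ∈ ({i}ᶜ : Finset (Fin m)), k ≠ i := fun k hk => by simpa using hk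
  -- Finitely many strict inequalities at `P` persist at `(1 + δ) P`, which makes the coefficients
  -- of the other lines summable beyond the critical point.
  obtain ⟨δ, hδ, hδ0⟩ : ∃ δ : ℝ, (∀ k, k ≠ i →
      0 < factor (a k) (b k) ((1 + δ) * P.1) ((1 + δ) * P.2)) ∧ 0 < δ := by
    have hev : ∀ᶠ δ : ℝ in 𝓝 0, ∀ k, k ≠ i →
        0 < factor (a k) (b k) ((1 + δ) * P.1) ((1 + δ) * P.2) := by
      rw [eventually_all]
      intro k
      by_cases hk : k = i
      · simp [hk]
      · have hc : Continuous fun δ : ℝ => factor (a k) (b k) ((1 + δ) * P.1) ((1 + δ) * P.2) := by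
          simp only [factor]; fun_prop
        filter_upwards [hc.continuousAt.eventually_const_lt (by simpa using hpos k hk)] with δ h _
        exact h
    have hev' : ∀ᶠ δ : ℝ in 𝓝[>] 0, ∀ k, k ≠ i →
        0 < factor (a k) (b k) ((1 + δ) * P.1) ((1 + δ) * P.2) := nhdsWithin_le_nhds hev
    exact (hev'.and self_mem_nhdsWithin).exists
  have hsum := he.hasSum_real (P := ((1 + δ) * P.1, (1 + δ) * P.2)) (by positivity) (by positivity)
    fun k hk => hδ k (hmem k hk)
  have hval := he.hasSum_real P1.le P2.le fun k hk => hpos k (hmem k hk)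
  have hlim := tendsto_conv_linCoeff (ha i) (hb i) hp hq he.nonneg hδ0 hsum.summable
  rw [← hPdef, hval.tsum_eq] at hlim
  have hprod : 0 < ∏ k ∈ ({i}ᶜ : Finset (Fin m)), 1 / factor (a k) (b k) P.1 P.2 :=
    Finset.prod_pos fun k hk => one_div_pos.2 (hpos k (hmem k hk))
  set c₀ := (∏ k ∈ ({i}ᶜ : Finset (Fin m)), 1 / factor (a k) (b k) P.1 P.2) *
    (√((p + q : ℕ) : ℝ) / (√2 * √(p : ℝ) * √(q : ℝ)) / √Real.pi) with hc₀
  have hc₀pos : 0 < c₀ := by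
    have := Real.pi_pos
    positivity
  -- The factor `P.1 * P.2` accounts for the exponents `x + 1`, `y + 1` in place of `x`, `y`.
  refine ⟨c₀ * (P.1 * P.2), by positivity, ?_⟩
  have hlim2 : Tendsto (fun k : ℕ => conv e (linCoeff (a i) (b i)) (k * p, k * q) *
      (√(k : ℝ) * (P.1 ^ (k * p + 1) * P.2 ^ (k * q + 1)))) atTop (𝓝 (c₀ * (P.1 * P.2))) := by
    refine (hlim.mul_const (P.1 * P.2)).congr fun k => ?_
    simp only [bimon, pow_succ]; ring
  have heq := isEquivalent_ofReal_of_tendsto (by positivity) ?_ hlim2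
  · have e1 : (fun k : ℕ => f (k * p) (k * q)) =
        fun k : ℕ => ((conv e (linCoeff (a i) (b i)) (k * p, k * q) : ℝ) : ℂ) :=
      funext fun k => hfe _ _
    rw [e1]
    refine heq.congr_right (Eventually.of_forall fun k => ?_)
    simp only
    congr 1
    rw [← one_div_mul_one_div]
    ring
  · filter_upwards [eventually_gt_atTop 0] with k hk
    have : 0 < √(k : ℝ) := Real.sqrt_pos.2 (by positivity)
    positivity

/-- Interior membership gives the strict inequalities needed for the two tail limits, and general
position makes all other factors positive at the vertex, where their generating function takes the
value `A i j`. -/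
theorem asymptotics_coneOmega {m : ℕ} {a b : Fin m → ℝ} (ha : ∀ i, 0 < a i) (hb : ∀ i, 0 < b i)
    (hgp : GeneralPosition a b) {f : ℕ → ℕ → ℂ} (hf : IsTaylorCoeff (ratFun a b) f)
    {A : Fin m → Fin m → ℝ} {i j : Fin m}
    (hA : A i j = ∏ k ∈ ({i, j} : Finset (Fin m))ᶜ,
      1 / factor (a k) (b k) (crossPt a b i j).1 (crossPt a b i j).2)
    (hΔ : Delta a b i j < 0) {p q : ℕ} (hd : dir p q ∈ interior (coneOmega a b i j)) :
    (fun k : ℕ => f (k * p) (k * q)) ~[atTop] fun k : ℕ =>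
      ((-A i j / Delta a b i j * (1 / ((crossPt a b i j).1 ^ (k * p + 1) *
        (crossPt a b i j).2 ^ (k * q + 1))) : ℝ) : ℂ) := by
  have d1 := fst_pos_of_mem_interior (fun d hd => hd.1) hd
  have d2 := snd_pos_of_mem_interior (fun d hd => hd.2.1) hd
  have hp : 0 < p := Nat.cast_pos.1 d1
  have hq : 0 < q := Nat.cast_pos.1 d2
  have hmem := interior_subset hd
  obtain ⟨P1, P2⟩ := pos_of_isMaxOn d1 d2 hmem.2.2.1 hmem.2.2.2
  have hij : i ≠ j := by rintro rfl; simp [Delta] at hΔ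
  obtain ⟨hi, hj⟩ := crossPt_spec a b i j hΔ.ne
  have hlo := pos_of_mem_interior_of_subset (fun h => (mul_pos (hb i) P2).ne' h.1)
    (fun d hd => (inequalities_of_mem_coneOmega hgp hΔ P1 P2 hd).1) hd
  have hhi := pos_of_mem_interior_of_subset (fun h => (mul_pos (ha j) P1).ne' h.2)
    (fun d hd => (inequalities_of_mem_coneOmega hgp hΔ P1 P2 hd).2) hd
  have hpos : ∀ k ∈ ({i, j} : Finset (Fin m))ᶜ,
      0 < factor (a k) (b k) (crossPt a b i j).1 (crossPt a b i j).2 := by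
    intro k hk
    simp only [Finset.mem_compl, Finset.mem_insert, Finset.mem_singleton, not_or] at hk
    exact (hmem.2.2.1.2.2 k).lt_of_ne (hgp.factor_ne_zero hij hk.1 hk.2 hi hj).symm
  set P := crossPt a b i j
  have ha' := fun i => (ha i).le
  have hb' := fun i => (hb i).le
  obtain ⟨e, he⟩ := exists_isProdCoeff ha' hb' ({i, j}ᶜ : Finset (Fin m))
  have hfe := taylorCoeff_eq_conv hf he (isProdCoeff_conv_linCoeff ha' hb' hij)
  have hval := he.hasSum_real P1.le P2.le hpos
  simp only [factor] at hi hj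
  simp only [dir] at hlo hhi
  have hlim := tendsto_conv_pair (P := P) (ha i) (hb i) (ha j) (hb j) P1 P2 (by linarith)
    (by linarith) hΔ.ne hp hq (by linarith) (by linarith) he.nonneg hval.summable
  rw [hval.tsum_eq, ← hA] at hlim
  have hApos : 0 < A i j := by
    rw [hA]
    exact Finset.prod_pos fun k hk => one_div_pos.2 (hpos k hk)
  have hc : -1 / (a i * b j - a j * b i) * A i j = -A i j / Delta a b i j := by
    rw [Delta]; ring
  rw [hc] at hlim
  have heq := isEquivalent_ofReal_of_tendsto (div_ne_zero (neg_ne_zero.2 hApos.ne') hΔ.ne)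
    (Eventually.of_forall fun k => by positivity) hlim
  have e1 : (fun k : ℕ => f (k * p) (k * q)) = fun k : ℕ =>
      ((conv e (conv (linCoeff (a i) (b i)) (linCoeff (a j) (b j))) (k * p, k * q) : ℝ) : ℂ) :=
    funext fun k => hfe _ _
  rw [e1]
  exact heq

end LinearPoles

end

theorem mainTheorem2 (m r : ℕ) (hm : 1 ≤ m) (a b : Fin m → ℝ)
    (ha : ∀ i, 0 < a i) (hb : ∀ i, 0 < b i)
    (hgp : LinearPoles.GeneralPosition a b) (hnum : LinearPoles.SidesFirst a b r)
    (f : ℕ → ℕ → ℂ) (hf : LinearPoles.IsTaylorCoeff (LinearPoles.ratFun a b) f) :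
    ∃ A : Fin m → Fin m → ℝ, (2 ≤ m → LinearPoles.IsPartialFraction a b A) ∧
      -- the asymptotics in the interior of `K_i`
      (∀ (i : Fin m) (p q : ℕ), LinearPoles.dir p q ∈ interior (LinearPoles.coneK a b i) →
        ∃ c : ℝ, 0 < c ∧
          (fun k : ℕ => f (k * p) (k * q)) ~[atTop] fun k : ℕ =>
            ((c / √(k : ℝ) *
              (1 / ((LinearPoles.critPt a b i (LinearPoles.dir p q)).1 ^ (k * p + 1) *
                (LinearPoles.critPt a b i (LinearPoles.dir p q)).2 ^ (k * q + 1))) : ℝ) : ℂ)) ∧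
      -- the asymptotics in the interior of `Ω_{i,i+1}`
      (∀ (i j : Fin m), j.val = i.val + 1 → j.val < r → ∀ p q : ℕ,
        LinearPoles.dir p q ∈ interior (LinearPoles.coneOmega a b i j) →
          (fun k : ℕ => f (k * p) (k * q)) ~[atTop] fun k : ℕ =>
            ((-A i j / LinearPoles.Delta a b i j *
              (1 / ((LinearPoles.crossPt a b i j).1 ^ (k * p + 1) *
                (LinearPoles.crossPt a b i j).2 ^ (k * q + 1))) : ℝ) : ℂ)) ∧
      -- almost every diagonal: off finitely many rays, `(p, q)` is interior to one of these cones,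
      -- and to every one of them that contains it
      ∃ E : Set (ℝ × ℝ), E.Finite ∧ ∀ p q : ℕ,
        (∀ e ∈ E, ∀ t : ℝ, 0 ≤ t → LinearPoles.dir p q ≠ t • e) →
          ((∃ i : Fin m, i.val < r ∧
              LinearPoles.dir p q ∈ interior (LinearPoles.coneK a b i)) ∨
            (∃ i j : Fin m, j.val = i.val + 1 ∧ j.val < r ∧
              LinearPoles.dir p q ∈ interior (LinearPoles.coneOmega a b i j))) ∧
          (∀ i : Fin m, LinearPoles.dir p q ∈ LinearPoles.coneK a b i →
            LinearPoles.dir p q ∈ interior (LinearPoles.coneK a b i)) ∧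
          (∀ i j : Fin m, j.val = i.val + 1 → j.val < r →
            LinearPoles.dir p q ∈ LinearPoles.coneOmega a b i j →
            LinearPoles.dir p q ∈ interior (LinearPoles.coneOmega a b i j)) := by
  obtain ⟨A, hA⟩ : ∃ A : Fin m → Fin m → ℝ, 2 ≤ m → ∀ P : ℂ × ℂ, 1 = ∑ i, ∑ j ∈ Finset.Ioi i,
      (A i j : ℂ) * LinearPoles.prodFactor a b ((Finset.univ.erase i).erase j) P := by
    by_cases h2 : 2 ≤ m
    · obtain ⟨A, hA⟩ := LinearPoles.exists_sum_prodFactor hgp h2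
      exact ⟨A, fun _ => hA⟩
    -- With a single line there is no pair of consecutive indices, so any `A` serves.
    · exact ⟨0, fun h => absurd h h2⟩
  refine ⟨A, fun h2 => LinearPoles.isPartialFraction_of_sum_prodFactor (hA h2),
    fun i p q hd => LinearPoles.asymptotics_coneK ha hb hgp hf hd, fun i j hij hjr p q hd => ?_,
    LinearPoles.boundaryRays a b, LinearPoles.finite_boundaryRays a b, fun p q hoff => ?_⟩
  · have hlt : i < j := by rw [Fin.lt_def]; omega
    have h2 : 2 ≤ m := by have := j.isLt; omega
    exact LinearPoles.asymptotics_coneOmega ha hb hgp hf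
      (LinearPoles.partialFraction_coeff_eq hgp (hA h2) hlt)
      (LinearPoles.Delta_neg_of_lt hb hnum hlt hjr) hd
  -- The two coordinate rays belong to the exceptional set, so both exponents are positive.
  · have h₁ : 0 < (LinearPoles.dir p q).1 := by
      refine lt_of_le_of_ne (Nat.cast_nonneg p) fun h0 => ?_
      refine hoff (0, 1) (Or.inl (Or.inl (by simp))) q (Nat.cast_nonneg q) ?_
      ext
      · simpa using h0.symm
      · simp [LinearPoles.dir]
    have h₂ : 0 < (LinearPoles.dir p q).2 := by
      refine lt_of_le_of_ne (Nat.cast_nonneg q) fun h0 => ?_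
      refine hoff (1, 0) (Or.inl (Or.inl (by simp))) p (Nat.cast_nonneg p) ?_
      ext
      · simp [LinearPoles.dir]
      · simpa using h0.symm
    have hK : ∀ i : Fin m, LinearPoles.dir p q ∈ LinearPoles.coneK a b i →
        LinearPoles.dir p q ∈ interior (LinearPoles.coneK a b i) := fun i hd =>
      LinearPoles.mem_interior_coneK_of_offRays ha hb hgp hoff h₁ h₂ hd
    have hΩ : ∀ i j : Fin m, j.val = i.val + 1 → j.val < r →
        LinearPoles.dir p q ∈ LinearPoles.coneOmega a b i j →
        LinearPoles.dir p q ∈ interior (LinearPoles.coneOmega a b i j) := fun i j hij hjr hd =>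
      LinearPoles.mem_interior_coneOmega_of_offRays ha hgp hoff h₁ h₂
        (LinearPoles.Delta_neg_of_lt hb hnum (by rw [Fin.lt_def]; omega) hjr) hd
    refine ⟨?_, hK, hΩ⟩
    rcases LinearPoles.exists_mem_cone hm ha hb hgp hnum h₁ h₂ with
      ⟨i, hir, hd⟩ | ⟨i, j, hij, hjr, hd⟩
    · exact Or.inl ⟨i, hir, hK i hd⟩
    · exact Or.inr ⟨i, j, hij, hjr, hΩ i j hij hjr hd⟩
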